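/- Let $k\ge 1$ and let $\beta=(\beta_{i,j})_{i,j\in\mathbb Z_+,\,i+j\le 2k}$ be a bivariate real multisequence of degree $2k$, and let in addition a real number $\beta_{3,2k-2}$ (a moment of degree $2k+1$) be given. Let $M(k)=(\beta_{i+i',j+j'})_{i+j\le k,\;i'+j'\le k}$ be the moment matrix, with columns denoted $X^{i}Y^{j}$; for a polynomial $p=\sum_{i+j\le k}a_{i,j}x^iy^j$ write $p(X,Y)=\sum a_{i,j}X^iY^j$ for the corresponding combination of columns. Suppose $M(k)$ is positive semidefinite and recursively generated, i.e. if $p,q,pq$ have degree at most $k$ and $p(X,Y)=0$, then $(pq)(X,Y)=0$. Notation. For a finite sequence $b=(b_0,\dots,b_{2n})$ let $A_b=(b_{i+j})_{i,j=0}^n$ be its Hankel matrix, with columns $\mathbf v_0,\dots,\mathbf v_n$; let $\operatorname{Rank} b=n+1$ if $A_b$ is nonsingular, and $\operatorname{Rank} b=\min\{i:\mathbf v_i\in\operatorname{span}\{\mathbf v_0,\dots,\mathbf v_{i-1}\}\}$ otherwise. $A^+$ is the Moore–Penrose inverse, and $M/A=d-cA^+b$ is the generalized Schur complement of $A$ in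 $M=\begin{pmatrix}A&b\\c&d\end{pmatrix}$. Put $u^{(i)}=(\beta_{0,i},\beta_{1,i},\beta_{2,i},\beta_{3,i})$ and $$\widehat\beta=(u^{(0)},\dots,u^{(2k-3)},\beta_{0,2k-2},\beta_{1,2k-2},\beta_{2,2k-2}),\qquad \widetilde\beta=(\widehat\beta,\beta_{3,2k-2},\beta_{0,2k-1}),$$ $$u=(u^{(k)},\dots,u^{(2k-2)},\beta_{0,2k-1},\beta_{1,2k-1}),\qquad s=(\beta_{3,k-1},u),\qquad w=(\beta_{2,k-1},\beta_{3,k-1},u^{(k)},\dots,u^{(2k-2)}),$$ $$\widetilde A=\begin{pmatrix}A_{\widehat\beta}&u^T\\u&\beta_{0,2k}\end{pmatrix},\qquad \Delta=(A_{\widetilde\beta}/A_{\widehat\beta})\,(\widetilde A/A_{\widehat\beta}),$$ where empty ranges of $u^{(i)}$ are omitted. A representing measure is a positive Borel measure $\mu$ on $\mathbb R^2$ supported on the curve $y=x^4$ with $\int x^iy^j\,d\mu=\beta_{i,j}$ (the integrand being integrable) for all $i+j\le 2k$ and also for $(i,j)=(3,2k-2)$. Then a representing measure exists if and only if all of the following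 hold: (0) $\Delta\ge 0$ (so that the square root is real) and $\;sA_{\widetilde\beta}^+s^T\le uA_{\widehat\beta}^+w^T+\sqrt{\Delta}$. (1) If $k\ge4$, then $Y=X^4$ is a column relation of $M(k)$. If $k=3$, then $\beta_{0,1}=\beta_{4,0}$, $\beta_{1,1}=\beta_{5,0}$, $\beta_{2,1}=\beta_{6,0}$, $\beta_{0,2}=\beta_{4,1}$, $\beta_{1,2}=\beta_{5,1}$, $\beta_{0,3}=\beta_{4,2}$. If $k=2$, then $\beta_{0,1}=\beta_{4,0}$. (No condition if $k=1$.) (2) Either $A_{\widetilde\beta}\succ0$, or $A_{\widetilde\beta}\succeq0$ and $\operatorname{Rank}A_{\widehat\beta}=\operatorname{Rank}A_{\widetilde\beta}=\operatorname{Rank}\begin{pmatrix}A_{\widetilde\beta}&s^T\end{pmatrix}=\operatorname{Rank}\widetilde A$. Moreover, suppose a representing measure exists. Then there is a $(\operatorname{Rank}\widetilde\beta)$-atomic representing measure if and only if $$sA_{\widetilde\beta}^+s^T\in\bigl\{uA_{\widehat\beta}^+w^T-\sqrt{\Delta},\;uA_{\widehat\beta}^+w^T+\sqrt{\Delta}\bigr\},$$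 and otherwise there is a $(\operatorname{Rank}\widetilde\beta+1)$-atomic representing measure. (A $t$-atomic measure is a sum of exactly $t$ distinct point masses with positive weights; the zero measure is $0$-atomic.) -/

import Mathlib

open MeasureTheory
open scoped Matrix

noncomputable section

namespace CurveTMP

/-! ### Moore-Penrose inverse and generalized Schur complement -/

/-- The four Penrose equations for real matrices. -/
structure IsMoorePenrose {m n : Type*} [Fintype m] [Fintype n]
    (A : Matrix m n ℝ) (B : Matrix n m ℝ) : Prop where
  mul_mul_self : A * B * A = A
  self_mul_mul : B * A * B = B
  symm_left : (A * B)ᵀ = A * B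
  symm_right : (B * A)ᵀ = B * A

theorem IsMoorePenrose.unique {m n : Type*} [Fintype m] [Fintype n]
    {A : Matrix m n ℝ} {B C : Matrix n m ℝ}
    (hB : IsMoorePenrose A B) (hC : IsMoorePenrose A C) : B = C := by
  have h1 : A * B = A * C := by
    calc A * B = (A * B)ᵀ := hB.symm_left.symm
      _ = ((A * C) * (A * B))ᵀ := by
          rw [← Matrix.mul_assoc (A * C) A B, hC.mul_mul_self]
      _ = (A * B) * (A * C) := by
          rw [Matrix.transpose_mul, hB.symm_left, hC.symm_left]
      _ = A * C := by rw [← Matrix.mul_assoc (A * B) A C, hB.mul_mul_self]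
  have h2 : B * A = C * A := by
    calc B * A = (B * A)ᵀ := hB.symm_right.symm
      _ = ((B * A) * (C * A))ᵀ := by
          rw [Matrix.mul_assoc B A (C * A), ← Matrix.mul_assoc A C A, hC.mul_mul_self]
      _ = (C * A) * (B * A) := by
          rw [Matrix.transpose_mul, hB.symm_right, hC.symm_right]
      _ = C * A := by
          rw [Matrix.mul_assoc C A (B * A), ← Matrix.mul_assoc A B A, hB.mul_mul_self]
  calc B = B * A * B := hB.self_mul_mul.symm
    _ = C * A * C := by rw [h2, Matrix.mul_assoc, h1, ← Matrix.mul_assoc]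
    _ = C := hC.self_mul_mul

theorem exists_isMoorePenrose_of_isHermitian {n : Type*} [Fintype n]
    {S : Matrix n n ℝ} (hS : S.IsHermitian) :
    ∃ T : Matrix n n ℝ, S * T * S = S ∧ T * S * T = T ∧ Tᵀ = T ∧ S * T = T * S := by
  classical
  let U : Matrix n n ℝ := hS.eigenvectorUnitary
  let d : n → ℝ := hS.eigenvalues
  have hU : Uᵀ * U = 1 := by
    have := Unitary.coe_star_mul_self hS.eigenvectorUnitary
    simpa [U, Matrix.star_eq_conjTranspose] using this
  have hSd : S = U * Matrix.diagonal d * Uᵀ := by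
    have := hS.spectral_theorem
    rw [Unitary.conjStarAlgAut_apply] at this
    simpa [U, d, Matrix.star_eq_conjTranspose, Function.comp_def] using this
  have key : ∀ a b : n → ℝ, (U * Matrix.diagonal a * Uᵀ) * (U * Matrix.diagonal b * Uᵀ)
      = U * Matrix.diagonal (fun i => a i * b i) * Uᵀ := by
    intro a b
    calc (U * Matrix.diagonal a * Uᵀ) * (U * Matrix.diagonal b * Uᵀ)
        = U * Matrix.diagonal a * (Uᵀ * U) * Matrix.diagonal b * Uᵀ := by
          simp only [Matrix.mul_assoc]
      _ = _ := by rw [hU, Matrix.mul_one, Matrix.mul_assoc U, Matrix.diagonal_mul_diagonal]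
  refine ⟨U * Matrix.diagonal (fun i => (d i)⁻¹) * Uᵀ, ?_, ?_, ?_, ?_⟩
  · rw [hSd, key, key]
    congr 3
    funext i
    exact mul_inv_mul_cancel (d i)
  · rw [hSd, key, key]
    congr 3
    funext i
    by_cases h : d i = 0
    · simp [h]
    · field_simp
  · simp [Matrix.transpose_mul, Matrix.mul_assoc]
  · rw [hSd, key, key]
    congr 3
    funext i
    exact mul_comm _ _

theorem exists_isMoorePenrose {m n : Type*} [Fintype m] [Fintype n]
    (A : Matrix m n ℝ) : ∃ B : Matrix n m ℝ, IsMoorePenrose A B := by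
  obtain ⟨T, h1, h2, h3, h4⟩ := exists_isMoorePenrose_of_isHermitian
    (S := Aᵀ * A) (by simpa using Matrix.isHermitian_conjTranspose_mul_self A)
  have hz : A * T * (Aᵀ * A) = A := by
    have h : (A * T * (Aᵀ * A) - A)ᵀ * (A * T * (Aᵀ * A) - A) = 0 := by
      have ht : (A * T * (Aᵀ * A) - A)ᵀ = (Aᵀ * A) * T * Aᵀ - Aᵀ := by
        simp [Matrix.transpose_mul, h3, Matrix.mul_assoc]
      have e : ((Aᵀ * A) * T * Aᵀ - Aᵀ) * (A * T * (Aᵀ * A) - A)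
          = ((Aᵀ * A) * T * (Aᵀ * A)) * T * (Aᵀ * A) - (Aᵀ * A) * T * (Aᵀ * A)
            - (Aᵀ * A) * T * (Aᵀ * A) + Aᵀ * A := by
        simp only [Matrix.sub_mul, Matrix.mul_sub, Matrix.mul_assoc]
        abel
      rw [ht, e, h1, h1]
      abel
    have h' : (A * T * (Aᵀ * A) - A)ᴴ * (A * T * (Aᵀ * A) - A) = 0 := by
      simpa [Matrix.conjTranspose_eq_transpose_of_trivial] using h
    exact sub_eq_zero.mp (Matrix.conjTranspose_mul_self_eq_zero.mp h')
  refine ⟨T * Aᵀ, ?_, ?_, ?_, ?_⟩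
  · simpa only [Matrix.mul_assoc] using hz
  · have : T * Aᵀ * A * (T * Aᵀ) = (T * (Aᵀ * A) * T) * Aᵀ := by
      simp only [Matrix.mul_assoc]
    rw [this, h2]
  · simp [Matrix.transpose_mul, h3, Matrix.mul_assoc]
  · have : T * Aᵀ * A = T * (Aᵀ * A) := Matrix.mul_assoc _ _ _
    rw [this, Matrix.transpose_mul, h3, Matrix.transpose_mul, Matrix.transpose_transpose, h4]

/-- The Moore-Penrose inverse `A⁺` of a real matrix. -/
def mpInv {m n : Type*} [Fintype m] [Fintype n] (A : Matrix m n ℝ) : Matrix n m ℝ :=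
  (exists_isMoorePenrose A).choose

theorem isMoorePenrose_mpInv {m n : Type*} [Fintype m] [Fintype n] (A : Matrix m n ℝ) :
    IsMoorePenrose A (mpInv A) :=
  (exists_isMoorePenrose A).choose_spec

/-- The number `v A⁺ zᵀ`, for row vectors `v`, `z` and a square matrix `A`. -/
def mpForm {n : ℕ} (A : Matrix (Fin n) (Fin n) ℝ) (v z : Fin n → ℝ) : ℝ :=
  v ⬝ᵥ (mpInv A *ᵥ z)

/-- The bordered matrix with blocks `A`, `vᵀ`, `v`, `c`. -/
def bordered {n : ℕ} (A : Matrix (Fin n) (Fin n) ℝ) (v : Fin n → ℝ) (c : ℝ) :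
    Matrix (Fin (n + 1)) (Fin (n + 1)) ℝ :=
  Matrix.of (Fin.snoc (α := fun _ => Fin (n + 1) → ℝ)
    (fun i => Fin.snoc (α := fun _ => ℝ) (A i) (v i)) (Fin.snoc (α := fun _ => ℝ) v c))

/-- The generalized Schur complement `M / A = d - c A⁺ b` of the leading block `A`, of size `n`,
in a matrix `M` of size `n + 1` with blocks `A`, `b` (a column), `c` (a row) and `d` (a number). -/
def schurCompl {n : ℕ} (M : Matrix (Fin (n + 1)) (Fin (n + 1)) ℝ) : ℝ :=
  M (Fin.last n) (Fin.last n) -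
    mpForm (M.submatrix Fin.castSucc Fin.castSucc)
      (fun j => M (Fin.last n) j.castSucc) (fun i => M i.castSucc (Fin.last n))

/-! ### Hankel matrices -/

/-- The Hankel matrix `(b_{i+j})_{0 ≤ i, j ≤ n}` of the sequence `(b_0, ..., b_{2n})`. -/
def hankel (b : ℕ → ℝ) (n : ℕ) : Matrix (Fin (n + 1)) (Fin (n + 1)) ℝ :=
  Matrix.of fun i j => b (i + j)

open Classical in
/-- The rank of the sequence `(b_0, ..., b_{2n})`: it is `n + 1` if its Hankel matrix is
nonsingular, and otherwise the least `i` such that the column `v_i` of the Hankel matrix lies in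
the span of the columns `v_0, ..., v_{i-1}`. -/
def seqRank (b : ℕ → ℝ) (n : ℕ) : ℕ :=
  if IsUnit (hankel b n) then n + 1
  else sInf {i : ℕ | ∃ h : i < n + 1, (hankel b n).col ⟨i, h⟩ ∈
    Submodule.span ℝ ((hankel b n).col '' {j : Fin (n + 1) | (j : ℕ) < i})}

/-! ### The bivariate moment matrix -/

/-- The exponents `(i, j)` of the monomials `x^i y^j` of degree at most `k`. -/
abbrev MonIdx (k : ℕ) : Type :=
  {p : ℕ × ℕ // p ∈ (Finset.range (k + 1) ×ˢ Finset.range (k + 1)).filter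
    (fun p => p.1 + p.2 ≤ k)}

/-- The moment matrix `M(k)`. A bivariate multisequence is a function `β : ℕ → ℕ → ℝ`; the
entries `β i j` with `i + j > 2k` do not occur here. -/
def momentMatrix (β : ℕ → ℕ → ℝ) (k : ℕ) : Matrix (MonIdx k) (MonIdx k) ℝ :=
  Matrix.of fun r c => β (r.1.1 + c.1.1) (r.1.2 + c.1.2)

/-- The vector `p(X)` in the column space of `M(k)`: the combination of the columns of `M(k)`
whose weights are the coefficients of `p`. Here `X 0` is `x` and `X 1` is `y`. -/
def colEval (β : ℕ → ℕ → ℝ) (k : ℕ) (p : MvPolynomial (Fin 2) ℝ) : MonIdx k → ℝ :=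
  momentMatrix β k *ᵥ
    fun c => p.coeff (Finsupp.single 0 c.1.1 + Finsupp.single 1 c.1.2)

/-- `M(k)` is recursively generated. -/
def RecursivelyGenerated (β : ℕ → ℕ → ℝ) (k : ℕ) : Prop :=
  ∀ p q : MvPolynomial (Fin 2) ℝ, p.totalDegree ≤ k → q.totalDegree ≤ k →
    (p * q).totalDegree ≤ k → colEval β k p = 0 → colEval β k (p * q) = 0

/-! ### Representing measures on the curve `y = x ^ 4` -/

/-- `μ` is a positive Borel measure supported on the curve `y = x ^ 4` with moments `β i j` for
`i + j ≤ 2k` and for the extra exponent `(3, 2k - 2)`, whose degree is `2k + 1`. -/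
def IsRepresenting (β : ℕ → ℕ → ℝ) (k : ℕ) (μ : Measure (ℝ × ℝ)) : Prop :=
  μ {z : ℝ × ℝ | z.2 = z.1 ^ 4}ᶜ = 0 ∧
  ∀ i j : ℕ, (i + j ≤ 2 * k ∨ (i = 3 ∧ j = 2 * k - 2)) →
    Integrable (fun z : ℝ × ℝ => z.1 ^ i * z.2 ^ j) μ ∧
      ∫ z : ℝ × ℝ, z.1 ^ i * z.2 ^ j ∂μ = β i j

/-- `μ` is `t`-atomic: a combination of exactly `t` point masses with positive densities. -/
def IsNAtomic (t : ℕ) (μ : Measure (ℝ × ℝ)) : Prop :=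
  ∃ (z : Fin t → ℝ × ℝ) (c : Fin t → ℝ), Function.Injective z ∧ (∀ l, 0 < c l) ∧
    μ = ∑ l, ENNReal.ofReal (c l) • Measure.dirac (z l)

/-! ### The data of the criterion

With `u^(i) = (β_{0,i}, β_{1,i}, β_{2,i}, β_{3,i})`, the sequence `uSeq β` is the concatenation of
`u^(0), u^(1), u^(2), ...`. Only its entries number `0, ..., 8k - 3` and `8k` are used below. All of
them are moments of degree at most `2k`, except entry number `8k - 5`, which is the extra moment
`β_{3,2k-2}`. -/

/-- The concatenation of `u^(0), u^(1), u^(2), ...`. -/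
def uSeq (β : ℕ → ℕ → ℝ) (m : ℕ) : ℝ := β (m % 4) (m / 4)

/-- The Hankel matrix, of size `4k - 2`, of
`(u^(0), ..., u^(2k-3), β_{0,2k-2}, β_{1,2k-2}, β_{2,2k-2})`. -/
def AHat (β : ℕ → ℕ → ℝ) (k : ℕ) : Matrix (Fin (4 * k - 3 + 1)) (Fin (4 * k - 3 + 1)) ℝ :=
  hankel (uSeq β) (4 * k - 3)

/-- The Hankel matrix, of size `4k - 1`, of `(u^(0), ..., u^(2k-2), β_{0,2k-1})`. -/
def ATilde (β : ℕ → ℕ → ℝ) (k : ℕ) :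
    Matrix (Fin (4 * k - 3 + 1 + 1)) (Fin (4 * k - 3 + 1 + 1)) ℝ :=
  hankel (uSeq β) (4 * k - 3 + 1)

/-- The rank of the sequence `(u^(0), ..., u^(2k-2), β_{0,2k-1})`. -/
def rankTilde (β : ℕ → ℕ → ℝ) (k : ℕ) : ℕ := seqRank (uSeq β) (4 * k - 3 + 1)

/-- The vector `u = (u^(k), ..., u^(2k-2), β_{0,2k-1}, β_{1,2k-1})`. -/
def vecU (β : ℕ → ℕ → ℝ) (k : ℕ) : Fin (4 * k - 3 + 1) → ℝ :=
  fun i => uSeq β (4 * k + i)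

/-- The vector `s = (β_{3,k-1}, u^(k), ..., u^(2k-2), β_{0,2k-1}, β_{1,2k-1})`. -/
def vecS (β : ℕ → ℕ → ℝ) (k : ℕ) : Fin (4 * k - 3 + 1 + 1) → ℝ :=
  fun i => uSeq β (4 * k - 1 + i)

/-- The vector `w = (β_{2,k-1}, β_{3,k-1}, u^(k), ..., u^(2k-2))`. -/
def vecW (β : ℕ → ℕ → ℝ) (k : ℕ) : Fin (4 * k - 3 + 1) → ℝ :=
  fun i => uSeq β (4 * k - 2 + i)

/-- The bordered matrix with blocks `AHat`, `uᵀ`, `u`, `β_{0,2k}`. -/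
def AWide (β : ℕ → ℕ → ℝ) (k : ℕ) :
    Matrix (Fin (4 * k - 3 + 1 + 1)) (Fin (4 * k - 3 + 1 + 1)) ℝ :=
  bordered (AHat β k) (vecU β k) (β 0 (2 * k))

/-- The number under the square root: the product of the Schur complements of `AHat` in `ATilde`
and in `AWide`. -/
def radicand (β : ℕ → ℕ → ℝ) (k : ℕ) : ℝ :=
  schurCompl (ATilde β k) * schurCompl (AWide β k)

/-- `Y = X ^ 4` is a column relation of `M(k)`, for `k ≥ 4`; for `k < 4`, where `X ^ 4` is not a
column of `M(k)`, these are the relations `β_{i+4,j} = β_{i,j+1}` between moments of degree at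
most `2k`. -/
def CurveRelations (β : ℕ → ℕ → ℝ) (k : ℕ) : Prop :=
  (4 ≤ k → colEval β k (MvPolynomial.X 1 - MvPolynomial.X 0 ^ 4) = 0) ∧
  (k = 3 → β 0 1 = β 4 0 ∧ β 1 1 = β 5 0 ∧ β 2 1 = β 6 0 ∧
    β 0 2 = β 4 1 ∧ β 1 2 = β 5 1 ∧ β 0 3 = β 4 2) ∧
  (k = 2 → β 0 1 = β 4 0)

end CurveTMP

end

open CurveTMP

namespace CurveTMP

/-! ### Linear algebra -/

/-! On the curve `y = x ^ 4` the monomial `x^i y^j` is `x^(i+4j)`, so the problem is univariate.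
With `N = 4k - 3`, a measure on the line is sought whose moments `b_0, ..., b_{2N+3}` and `b_{2N+6}`
are prescribed, while `b_{2N+4}` and `b_{2N+5}` are free.

Let `P`, `Q` be monic of degrees `N + 1`, `N + 3`, with all lower terms of degree at most `N`,
orthogonal to degrees at most `N`; let `R` be monic of degree `N + 2`, orthogonal to degrees at most
`N + 1`. Every expression with `A⁺` is a value of the Riesz functional on a product of two of these
(`mpForm_hankel_window`): `R²` gives `b_{2N+4} - lowerBound`, and the Gram matrix of `P`, `Q` has
the two Schur complements on its diagonal and `b_{2N+4} - center` off it. A measure therefore forces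
`b_{2N+4} ≥ lowerBound` and, by Cauchy-Schwarz, `(b_{2N+4} - center)² ≤ Δ`. Together these give
condition (0).

Conversely, let the Hankel matrix of size `N + 2` be positive definite. Take `b_{2N+4}` to be a root
of `(x - center)² = Δ`. A combination of `P` and `Q` is then null, and `b_{2N+5}` is chosen to fit
(`exists_agreeOffGap`). Gauss quadrature yields `N + 3` nodes if the root exceeds `lowerBound`, and
`N + 2` if it equals it; the null polynomial then reproduces `b_{2N+6}` by recursion. If the Hankel
matrix is singular, the rank conditions provide recursions that carry a smaller quadrature across
the gap (`exists_atoms_of_not_posDef`).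

A measure with at most `N + 2` atoms makes both `R` and the combination vanish at the atoms, so
`lowerBound` is one of the two roots (`IsPositiveUpTo.lowerBound_mem`). -/

theorem mpForm_mulVec {n : ℕ} {A : Matrix (Fin n) (Fin n) ℝ} (hA : Aᵀ = A) (g h : Fin n → ℝ) :
    mpForm A (A *ᵥ g) (A *ᵥ h) = g ⬝ᵥ (A *ᵥ h) := by
  have h1 : A *ᵥ g = g ᵥ* A := by rw [← Matrix.mulVec_transpose, hA]
  rw [mpForm, h1, ← Matrix.dotProduct_mulVec, Matrix.mulVec_mulVec, Matrix.mulVec_mulVec,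
    (isMoorePenrose_mpInv A).mul_mul_self]

theorem dotProduct_mulVec_comm {n : ℕ} {A : Matrix (Fin n) (Fin n) ℝ} (hA : Aᵀ = A)
    (g h : Fin n → ℝ) : g ⬝ᵥ (A *ᵥ h) = h ⬝ᵥ (A *ᵥ g) := by
  rw [Matrix.dotProduct_mulVec, ← Matrix.mulVec_transpose, hA, dotProduct_comm]

/-- The residual `z = b - A A⁺ b` lies in the kernel, by the transposed Penrose identity `A (A A⁺) =
A`. It is thus orthogonal to `b` and to the range, hence to itself. -/
theorem exists_mulVec_eq_of_orthogonal_ker {n : ℕ} {A : Matrix (Fin n) (Fin n) ℝ} (hA : Aᵀ = A)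
    (b : Fin n → ℝ) (hb : ∀ z, A *ᵥ z = 0 → b ⬝ᵥ z = 0) : ∃ g, A *ᵥ g = b := by
  refine ⟨mpInv A *ᵥ b, ?_⟩
  have mp := isMoorePenrose_mpInv A
  set z := b - A *ᵥ (mpInv A *ᵥ b) with hz
  have hAz : A *ᵥ z = 0 := by
    have : A * (A * mpInv A) = A := by
      have := congrArg Matrix.transpose mp.mul_mul_self
      rwa [Matrix.transpose_mul, mp.symm_left, hA] at this
    rw [hz, Matrix.mulVec_sub, Matrix.mulVec_mulVec, Matrix.mulVec_mulVec,
      Matrix.mul_assoc, this, sub_self]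
  have h0 : z ⬝ᵥ z = 0 := by
    nth_rewrite 1 [hz]
    rw [sub_dotProduct, hb z hAz, dotProduct_comm, dotProduct_mulVec_comm hA, hAz]
    simp
  have := dotProduct_self_eq_zero.mp h0
  exact (sub_eq_zero.mp this).symm

theorem mulVec_range_le_of_rank_le {m n l : Type*} [Fintype m] [Fintype n] [Fintype l]
    {C : Matrix m n ℝ} {M : Matrix m l ℝ} (h : ∀ v, ∃ w, M *ᵥ w = C *ᵥ v)
    (hr : M.rank ≤ C.rank) (w : l → ℝ) : ∃ v, C *ᵥ v = M *ᵥ w := by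
  have hle : LinearMap.range C.mulVecLin ≤ LinearMap.range M.mulVecLin := by
    rintro _ ⟨v, rfl⟩
    obtain ⟨w, hw⟩ := h v
    exact ⟨w, hw⟩
  have := Submodule.eq_of_le_of_finrank_le hle hr
  have hw : M *ᵥ w ∈ LinearMap.range M.mulVecLin := ⟨w, rfl⟩
  rw [← this] at hw
  exact hw

theorem rank_fromCols_replicateCol_eq_iff {n : ℕ} (A : Matrix (Fin n) (Fin n) ℝ) (b : Fin n → ℝ) :
    A.rank = (Matrix.fromCols A (Matrix.replicateCol (Fin 1) b)).rank ↔ ∃ g, A *ᵥ g = b := by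
  constructor
  · intro h
    obtain ⟨v, hv⟩ := mulVec_range_le_of_rank_le (C := A)
      (M := Matrix.fromCols A (Matrix.replicateCol (Fin 1) b))
      (fun v => ⟨Sum.elim v 0, by simp [Matrix.fromCols_mulVec]⟩) h.ge (Sum.elim 0 1)
    refine ⟨v, hv.trans ?_⟩
    ext i
    simp [Matrix.mulVec, dotProduct]
  · rintro ⟨g, rfl⟩
    apply le_antisymm
    · have := Matrix.rank_submatrix_le (Matrix.fromCols A (Matrix.replicateCol (Fin 1) (A *ᵥ g)))
        id (Sum.inl)
      have e : (Matrix.fromCols A (Matrix.replicateCol (Fin 1) (A *ᵥ g))).submatrix id Sum.inl =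
          A := by
        ext i j; simp
      rwa [e] at this
    · have : Matrix.fromCols A (Matrix.replicateCol (Fin 1) (A *ᵥ g)) =
          A * Matrix.fromCols 1 (Matrix.replicateCol (Fin 1) g) := by
        rw [Matrix.mul_fromCols, Matrix.mul_one, Matrix.replicateCol_mulVec]
      rw [this]
      exact Matrix.rank_mul_le_left _ _

/-! ### Bordered matrices and flat extensions -/

section bordered
variable {n : ℕ} (A : Matrix (Fin n) (Fin n) ℝ) (v : Fin n → ℝ) (c : ℝ)

@[simp] theorem bordered_castSucc_castSucc (i j : Fin n) :
    bordered A v c i.castSucc j.castSucc = A i j := by simp [bordered]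

@[simp] theorem bordered_castSucc_last (i : Fin n) :
    bordered A v c i.castSucc (Fin.last n) = v i := by simp [bordered]

@[simp] theorem bordered_last_castSucc (j : Fin n) :
    bordered A v c (Fin.last n) j.castSucc = v j := by simp [bordered]

@[simp] theorem bordered_last_last : bordered A v c (Fin.last n) (Fin.last n) = c := by
  simp [bordered]

theorem schurCompl_bordered : schurCompl (bordered A v c) = c - mpForm A v v := by
  have : (bordered A v c).submatrix Fin.castSucc Fin.castSucc = A := by
    ext i j; simp
  simp [schurCompl, this]

theorem hankel_transpose (b : ℕ → ℝ) (n : ℕ) : (hankel b n)ᵀ = hankel b n := by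
  ext i j; simp [hankel, add_comm]

theorem hankel_succ_eq_bordered (b : ℕ → ℝ) (n : ℕ) :
    hankel b (n + 1) = bordered (hankel b n) (fun i => b (n + 1 + i)) (b (n + 1 + (n + 1))) := by
  ext i j
  induction i using Fin.lastCases <;> induction j using Fin.lastCases <;>
    simp [hankel, add_comm]

variable {A v c}

/-- If bordering does not raise the rank, the first `n` columns already span the column space, so
the last column is a combination of them; its entries give both equations. -/
theorem rank_bordered_eq_iff (hA : Aᵀ = A) :
    A.rank = (bordered A v c).rank ↔ ∃ g, A *ᵥ g = v ∧ g ⬝ᵥ v = c := by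
  constructor
  · intro h
    let C : Matrix (Fin (n + 1)) (Fin n) ℝ := (bordered A v c).submatrix id Fin.castSucc
    have hC : A.rank ≤ C.rank := by
      have := Matrix.rank_submatrix_le C Fin.castSucc id
      have e : C.submatrix Fin.castSucc id = A := by
        ext i j; simp [C]
      rwa [e] at this
    obtain ⟨g, hg⟩ := mulVec_range_le_of_rank_le (C := C) (M := bordered A v c)
      (fun g => ⟨Fin.snoc (α := fun _ => ℝ) g 0, by
        ext i; simp [Matrix.mulVec, dotProduct, Fin.sum_univ_castSucc, C]⟩) (h.ge.trans hC)
      (Fin.snoc (α := fun _ => ℝ) 0 1)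
    refine ⟨g, ?_, ?_⟩
    · ext i
      have := congrFun hg i.castSucc
      simpa [Matrix.mulVec, dotProduct, Fin.sum_univ_castSucc, C] using this
    · have := congrFun hg (Fin.last n)
      rw [dotProduct_comm]
      simpa [Matrix.mulVec, dotProduct, Fin.sum_univ_castSucc, C] using this
  · rintro ⟨g, rfl, rfl⟩
    apply le_antisymm
    · have := Matrix.rank_submatrix_le (bordered A (A *ᵥ g) (g ⬝ᵥ A *ᵥ g)) Fin.castSucc
        Fin.castSucc
      have e : (bordered A (A *ᵥ g) (g ⬝ᵥ A *ᵥ g)).submatrix Fin.castSucc Fin.castSucc = A := by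
        ext i j; simp
      rwa [e] at this
    -- `R` is the identity with the row `g` appended, so the bordered matrix is the congruence `R A
    -- Rᵀ`.
    · let R : Matrix (Fin (n + 1)) (Fin n) ℝ :=
        Matrix.of fun i j =>
          Fin.snoc (α := fun _ => ℝ) (fun l => (1 : Matrix (Fin n) (Fin n) ℝ) l j) (g j) i
      have e : bordered A (A *ᵥ g) (g ⬝ᵥ A *ᵥ g) = R * A * Rᵀ := by
        have hs : ∀ (i : Fin n) (B : Matrix (Fin n) (Fin n) ℝ),
            (R * B) i.castSucc = B i := by
          intro i B; ext j; simp [R, Matrix.mul_apply, Matrix.one_apply]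
        have hl : ∀ (B : Matrix (Fin n) (Fin n) ℝ),
            (R * B) (Fin.last n) = g ᵥ* B := by
          intro B; ext j; simp [R, Matrix.mul_apply, Matrix.vecMul, dotProduct]
        have hr1 : ∀ w : Fin n → ℝ, ∀ i : Fin n, w ⬝ᵥ (R i.castSucc) = w i := by
          intro w i; simp [R, dotProduct, Matrix.one_apply]
        have hr2 : ∀ w : Fin n → ℝ, w ⬝ᵥ (R (Fin.last n)) = w ⬝ᵥ g := by
          intro w; simp [R, dotProduct]
        have hm : ∀ i j, (R * A * Rᵀ) i j = ((R * A) i) ⬝ᵥ (R j) := by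
          intro i j; simp [Matrix.mul_apply, dotProduct]
        ext i j
        rw [hm]
        induction i using Fin.lastCases <;> induction j using Fin.lastCases <;>
          simp only [hs, hl, hr1, hr2, bordered_castSucc_castSucc, bordered_castSucc_last,
            bordered_last_castSucc, bordered_last_last]
        · rw [Matrix.dotProduct_mulVec]
        · rw [← Matrix.mulVec_transpose, hA]
        · rfl
      rw [e, Matrix.mul_assoc]
      exact (Matrix.rank_mul_le_right _ _).trans (Matrix.rank_mul_le_left _ _)

end bordered

/-! ### Simultaneous diagonalization of two quadratic forms -/

theorem exists_spectral_decomposition {n : Type*} [Fintype n] [DecidableEq n]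
    {S : Matrix n n ℝ} (hS : S.IsHermitian) :
    ∃ U : Matrix n n ℝ, Uᵀ * U = 1 ∧ U * Uᵀ = 1 ∧
      S = U * Matrix.diagonal hS.eigenvalues * Uᵀ := by
  refine ⟨hS.eigenvectorUnitary, ?_, ?_, ?_⟩
  · have := Unitary.coe_star_mul_self hS.eigenvectorUnitary
    simpa [Matrix.star_eq_conjTranspose] using this
  · have := Unitary.coe_mul_star_self hS.eigenvectorUnitary
    simpa [Matrix.star_eq_conjTranspose] using this
  · have := hS.spectral_theorem
    rw [Unitary.conjStarAlgAut_apply] at this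
    simpa [Matrix.star_eq_conjTranspose, Function.comp_def] using this

/-- A square root `B` of `H` (`H = Bᵀ B`, with inverse `C`) turns `H` into the identity. The
transformed `Cᵀ K C` is symmetric and is diagonalized by an orthogonal matrix, which preserves the
identity. -/
theorem exists_simultaneous_diagonalization {n : Type*} [Fintype n] [DecidableEq n]
    {H K : Matrix n n ℝ} (hH : H.PosDef) (hK : Kᵀ = K) :
    ∃ (Q : Matrix n n ℝ) (t : n → ℝ), IsUnit Q ∧ H = Qᵀ * Q ∧ K = Qᵀ * Matrix.diagonal t * Q := by
  obtain ⟨U, hU1, hU2, hU⟩ := exists_spectral_decomposition hH.isHermitian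
  set d := hH.isHermitian.eigenvalues
  have hd : ∀ i, 0 < d i := hH.eigenvalues_pos
  set e : n → ℝ := fun i => Real.sqrt (d i)
  have he : ∀ i, e i ≠ 0 := fun i => (Real.sqrt_pos.mpr (hd i)).ne'
  have hdd : Matrix.diagonal e * Matrix.diagonal e = Matrix.diagonal d := by
    rw [Matrix.diagonal_mul_diagonal]
    congr 1
    funext i
    exact Real.mul_self_sqrt (hd i).le
  have hee : Matrix.diagonal e * Matrix.diagonal (fun i => (e i)⁻¹) = 1 := by
    rw [Matrix.diagonal_mul_diagonal, ← Matrix.diagonal_one]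
    congr 1
    funext i
    exact mul_inv_cancel₀ (he i)
  set B := Matrix.diagonal e * Uᵀ
  set C := U * Matrix.diagonal (fun i => (e i)⁻¹)
  have hBC : B * C = 1 := by
    calc B * C = Matrix.diagonal e * (Uᵀ * U) * Matrix.diagonal (fun i => (e i)⁻¹) := by
          simp only [B, C, Matrix.mul_assoc]
      _ = 1 := by rw [hU1, Matrix.mul_one, hee]
  have hCB : C * B = 1 := mul_eq_one_comm.mp hBC
  have hBB : Bᵀ * B = H := by
    calc Bᵀ * B = U * (Matrix.diagonal e * Matrix.diagonal e) * Uᵀ := by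
          simp only [B, Matrix.transpose_mul, Matrix.transpose_transpose, Matrix.diagonal_transpose,
            Matrix.mul_assoc]
      _ = H := by rw [hdd, ← hU]
  have hS : (Cᵀ * K * C).IsHermitian := by
    rw [Matrix.IsHermitian, Matrix.conjTranspose_eq_transpose_of_trivial]
    simp only [Matrix.transpose_mul, Matrix.transpose_transpose, hK, Matrix.mul_assoc]
  obtain ⟨V, hV1, hV2, hV⟩ := exists_spectral_decomposition hS
  generalize hS.eigenvalues = t at hV
  refine ⟨Vᵀ * B, t, ?_, ?_, ?_⟩
  · have : (Vᵀ * B) * (C * V) = 1 := by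
      calc (Vᵀ * B) * (C * V) = Vᵀ * (B * C) * V := by simp only [Matrix.mul_assoc]
        _ = 1 := by rw [hBC, Matrix.mul_one, hV1]
    exact IsUnit.of_mul_eq_one _ this
  · calc H = Bᵀ * (V * Vᵀ) * B := by rw [hV2, Matrix.mul_one, hBB]
      _ = _ := by simp only [Matrix.transpose_mul, Matrix.transpose_transpose, Matrix.mul_assoc]
  · have hCB' : Bᵀ * Cᵀ = 1 := by rw [← Matrix.transpose_mul, hCB, Matrix.transpose_one]
    calc K = (Bᵀ * Cᵀ) * K * (C * B) := by rw [hCB, hCB', Matrix.one_mul, Matrix.mul_one]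
      _ = Bᵀ * (Cᵀ * K * C) * B := by simp only [Matrix.mul_assoc]
      _ = _ := by
        rw [hV]
        simp only [Matrix.transpose_mul, Matrix.transpose_transpose, Matrix.mul_assoc]

/-! ### Gauss quadrature -/

/-- The moments of the atomic measure with nodes `t` and weights `w`. -/
def atomicMoment {m : ℕ} (t w : Fin m → ℝ) (j : ℕ) : ℝ := ∑ l, w l * t l ^ j

/-- The Hankel matrix and its shift by one are diagonalized simultaneously. Column `i + 1` of the
first is column `i` of the second, so `Q` is a Vandermonde matrix with rows scaled by its first
column: the diagonal entries are the nodes and the squares of the first column are the weights. The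
shift is what reaches the moment `2m - 1`. -/
theorem exists_gauss_quadrature (b : ℕ → ℝ) (m : ℕ)
    (hH : (Matrix.of fun i j : Fin m => b (i + j)).PosDef) :
    ∃ t w : Fin m → ℝ, Function.Injective t ∧ (∀ l, 0 < w l) ∧
      ∀ j < 2 * m, atomicMoment t w j = b j := by
  obtain ⟨Q, t, hQ, hHQ, hKQ⟩ := exists_simultaneous_diagonalization hH
    (K := Matrix.of fun i j : Fin m => b (i + j + 1)) (by ext i j; simp [add_comm])
  rcases Nat.eq_zero_or_pos m with rfl | hm
  · exact ⟨t, t, fun i => i.elim0, fun i => i.elim0, fun j hj => by omega⟩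
  have hrec : ∀ (i : ℕ) (hi : i + 1 < m) (l : Fin m),
      Q l ⟨i + 1, hi⟩ = t l * Q l ⟨i, by omega⟩ := by
    intro i hi l
    have h1 : Qᵀ *ᵥ (fun l => Q l ⟨i + 1, hi⟩) = Qᵀ *ᵥ (fun l => t l * Q l ⟨i, by omega⟩) := by
      ext j
      have e1 := congrFun (congrFun hHQ j) ⟨i + 1, hi⟩
      have e2 := congrFun (congrFun hKQ j) ⟨i, by omega⟩
      rw [Matrix.mul_apply] at e1
      rw [Matrix.mul_assoc, Matrix.mul_apply] at e2
      simp only [Matrix.of_apply, Matrix.transpose_apply, Matrix.diagonal_mul] at e1 e2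
      simp only [Matrix.mulVec, dotProduct, Matrix.transpose_apply]
      rw [← e1, ← e2, add_assoc]
    have hQt : IsUnit Qᵀ := (Matrix.isUnit_transpose Q).mpr hQ
    exact congrFun (Matrix.mulVec_injective_iff_isUnit.mpr hQt h1) l
  have hpow : ∀ (i : ℕ) (hi : i < m) (l : Fin m), Q l ⟨i, hi⟩ = t l ^ i * Q l ⟨0, hm⟩ := by
    intro i
    induction i with
    | zero => intro hi l; simp
    | succ i ih => intro hi l; rw [hrec i hi l, ih (by omega) l]; ring
  have hinj : Function.Injective (fun v : Fin m → ℝ => v ᵥ* Q) :=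
    Matrix.vecMul_injective_iff_isUnit.mpr hQ
  have hne : ∀ l, Q l ⟨0, hm⟩ ≠ 0 := by
    intro l hl
    have : Pi.single l (1 : ℝ) = 0 := hinj (by
      ext j
      have := hpow j j.2 l
      simp only [Fin.eta] at this
      simp [this, hl])
    simpa using congrFun this l
  refine ⟨t, fun l => Q l ⟨0, hm⟩ ^ 2, ?_, fun l => by have := hne l; positivity, ?_⟩
  · intro l l' hll
    by_contra hne'
    -- Equal nodes would make rows `l` and `l'` of `Q` proportional, with the entries of the first
    -- column as factors.
    have : Pi.single l (Q l' ⟨0, hm⟩) = Pi.single l' (Q l ⟨0, hm⟩) := hinj (by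
      ext j
      have h1 := hpow j j.2 l
      have h2 := hpow j j.2 l'
      simp only [Fin.eta] at h1 h2
      simp [h1, h2, hll]
      ring)
    have := congrFun this l
    rw [Pi.single_eq_same, Pi.single_eq_of_ne hne'] at this
    exact hne l' this
  · intro j hj
    by_cases hj' : j < m
    · have e := congrFun (congrFun hHQ ⟨j, hj'⟩) ⟨0, hm⟩
      simp only [Matrix.of_apply, Matrix.mul_apply, Matrix.transpose_apply, hpow j hj'] at e
      rw [add_zero] at e
      rw [e, atomicMoment]
      exact Finset.sum_congr rfl fun l _ => by ring
    -- For `j ≥ m`, the moment `b j` is read from the last column of the shifted matrix.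
    · have e := congrFun (congrFun hKQ ⟨j - m, by omega⟩) ⟨m - 1, by omega⟩
      rw [Matrix.mul_assoc, Matrix.mul_apply] at e
      simp only [Matrix.of_apply, Matrix.transpose_apply, Matrix.diagonal_mul,
        hpow (j - m) (by omega), hpow (m - 1) (by omega)] at e
      rw [show j - m + (m - 1) + 1 = j by omega] at e
      rw [e, atomicMoment]
      refine Finset.sum_congr rfl fun l _ => ?_
      have : t l ^ j = t l ^ (j - m) * t l * t l ^ (m - 1) := by
        rw [← pow_succ, ← pow_add]; congr 1; omega
      rw [this]; ring

/-! ### The Riesz functional and the Hankel form -/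

open Polynomial

/-- The Riesz functional of a sequence: the linear functional on `ℝ[X]` with `X ^ j ↦ b j`. -/
noncomputable def riesz (b : ℕ → ℝ) : Polynomial ℝ →ₗ[ℝ] ℝ :=
  Polynomial.lsum fun j => b j • LinearMap.id

/-- The polynomial whose coefficients are the entries of a vector. -/
noncomputable def vecPoly {m : ℕ} (v : Fin m → ℝ) : Polynomial ℝ := ∑ i, C (v i) * X ^ (i : ℕ)

/-- The section `(b_d, b_{d+1}, ...)` of a sequence. -/
def window (b : ℕ → ℝ) (m d : ℕ) : Fin m → ℝ := fun i => b (d + i)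

section riesz
variable (b : ℕ → ℝ)

@[simp] theorem riesz_C_mul_X_pow (a : ℝ) (j : ℕ) : riesz b (C a * X ^ j) = a * b j := by
  rw [riesz, Polynomial.lsum_apply, C_mul_X_pow_eq_monomial, Polynomial.sum_monomial_index] <;>
    simp [mul_comm]

@[simp] theorem riesz_X_pow (j : ℕ) : riesz b (X ^ j) = b j := by
  simpa using riesz_C_mul_X_pow b 1 j

@[simp] theorem riesz_C_mul (a : ℝ) (p : ℝ[X]) : riesz b (C a * p) = a * riesz b p := by
  rw [← smul_eq_C_mul, map_smul, smul_eq_mul]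

variable {b}

theorem riesz_eq_sum {p : ℝ[X]} {m : ℕ} (hp : p.natDegree < m) :
    riesz b p = ∑ j ∈ Finset.range m, p.coeff j * b j := by
  conv_lhs => rw [p.as_sum_range_C_mul_X_pow' hp]
  simp

theorem riesz_congr {b' : ℕ → ℝ} {p : ℝ[X]} {d : ℕ} (h : ∀ j ≤ d, b j = b' j)
    (hp : p.natDegree ≤ d) : riesz b p = riesz b' p := by
  rw [riesz_eq_sum (Nat.lt_succ_of_le hp), riesz_eq_sum (Nat.lt_succ_of_le hp)]
  refine Finset.sum_congr rfl fun j hj => ?_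
  rw [h j (by simpa using Finset.mem_range_succ_iff.mp hj)]

theorem vecPoly_coeff {m : ℕ} {p : ℝ[X]} (hp : p.natDegree < m) :
    vecPoly (fun i : Fin m => p.coeff i) = p := by
  rw [vecPoly, Fin.sum_univ_eq_sum_range (fun i => C (p.coeff i) * X ^ i)]
  exact (p.as_sum_range_C_mul_X_pow' hp).symm

theorem coeff_vecPoly {m : ℕ} (v : Fin m → ℝ) (i : Fin m) : (vecPoly v).coeff i = v i := by
  simp [vecPoly, coeff_C_mul, coeff_X_pow, Fin.val_inj]

theorem vecPoly_ne_zero {m : ℕ} {v : Fin m → ℝ} (hv : v ≠ 0) : vecPoly v ≠ 0 := by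
  contrapose! hv
  ext i
  rw [← coeff_vecPoly v i, hv]
  simp

theorem natDegree_vecPoly_lt {m : ℕ} (hm : 0 < m) (v : Fin m → ℝ) :
    (vecPoly v).natDegree < m := by
  have : (vecPoly v).natDegree ≤ m - 1 := by
    refine natDegree_sum_le_of_forall_le _ _ fun i _ => ?_
    exact (natDegree_C_mul_X_pow_le _ _).trans (by omega)
  omega

theorem riesz_mul_vecPoly {m : ℕ} (q : ℝ[X]) (v : Fin m → ℝ) :
    riesz b (q * vecPoly v) = ∑ i : Fin m, v i * riesz b (q * X ^ (i : ℕ)) := by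
  rw [vecPoly, Finset.mul_sum, map_sum]
  refine Finset.sum_congr rfl fun i _ => ?_
  rw [mul_left_comm, riesz_C_mul]

theorem riesz_vecPoly_mul_X_pow {m : ℕ} (v : Fin m → ℝ) (j : ℕ) :
    riesz b (vecPoly v * X ^ j) = window b m j ⬝ᵥ v := by
  rw [mul_comm, riesz_mul_vecPoly, dotProduct]
  refine Finset.sum_congr rfl fun i _ => ?_
  rw [← pow_add, riesz_X_pow, window, mul_comm]

theorem riesz_mul_eq_zero {q r : ℝ[X]} {m : ℕ} (h : ∀ j < m, riesz b (q * X ^ j) = 0)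
    (hr : r.natDegree < m) : riesz b (q * r) = 0 := by
  rw [← vecPoly_coeff hr, riesz_mul_vecPoly]
  exact Finset.sum_eq_zero fun i _ => by rw [h i i.2, mul_zero]

theorem mulVec_apply_eq_riesz {m : ℕ} (v : Fin m → ℝ) (i : Fin m) :
    ((Matrix.of fun i j : Fin m => b (i + j)) *ᵥ v) i = riesz b (vecPoly v * X ^ (i : ℕ)) := by
  rw [riesz_vecPoly_mul_X_pow]
  rfl

theorem dotProduct_mulVec_eq_riesz {m : ℕ} (v v' : Fin m → ℝ) :
    v ⬝ᵥ ((Matrix.of fun i j : Fin m => b (i + j)) *ᵥ v') =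
      riesz b (vecPoly v' * vecPoly v) := by
  rw [riesz_mul_vecPoly, dotProduct]
  exact Finset.sum_congr rfl fun i _ => by rw [mulVec_apply_eq_riesz]

theorem isHermitian_of_add {m : ℕ} :
    (Matrix.of fun i j : Fin m => b (i + j)).IsHermitian := by
  ext i j; simp [add_comm]

theorem posDef_iff_riesz_pos {m : ℕ} : (Matrix.of fun i j : Fin m => b (i + j)).PosDef ↔
    ∀ q : ℝ[X], q ≠ 0 → q.natDegree < m → 0 < riesz b (q * q) := by
  constructor
  · intro h q hq hd
    have hv : (fun i : Fin m => q.coeff i) ≠ 0 := by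
      intro h0
      apply hq
      rw [← vecPoly_coeff hd, h0]
      simp [vecPoly]
    have := h.dotProduct_mulVec_pos hv
    rwa [star_trivial, dotProduct_mulVec_eq_riesz, vecPoly_coeff hd] at this
  · intro h
    refine Matrix.PosDef.of_dotProduct_mulVec_pos isHermitian_of_add fun v hv => ?_
    rw [star_trivial, dotProduct_mulVec_eq_riesz]
    rcases Nat.eq_zero_or_pos m with rfl | hm
    · exact absurd (Subsingleton.elim _ _) hv
    · exact h _ (vecPoly_ne_zero hv) (natDegree_vecPoly_lt hm v)

theorem posSemidef_iff_riesz_nonneg {m : ℕ} :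
    (Matrix.of fun i j : Fin m => b (i + j)).PosSemidef ↔
    ∀ q : ℝ[X], q.natDegree < m → 0 ≤ riesz b (q * q) := by
  rw [Matrix.posSemidef_iff_dotProduct_mulVec]
  constructor
  · intro h q hd
    have := h.2 (fun i : Fin m => q.coeff i)
    rwa [star_trivial, dotProduct_mulVec_eq_riesz, vecPoly_coeff hd] at this
  · intro h
    refine ⟨isHermitian_of_add, fun v => ?_⟩
    rw [star_trivial, dotProduct_mulVec_eq_riesz]
    rcases Nat.eq_zero_or_pos m with rfl | hm
    · simp [vecPoly]
    · exact h _ (natDegree_vecPoly_lt hm v)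

theorem hankel_mulVec_eq_window_iff {n d : ℕ} (v : Fin (n + 1) → ℝ) :
    hankel b n *ᵥ v = window b (n + 1) d ↔
      ∀ j < n + 1, riesz b ((X ^ d - vecPoly v) * X ^ j) = 0 := by
  have key : ∀ j : Fin (n + 1), riesz b ((X ^ d - vecPoly v) * X ^ (j : ℕ)) =
      window b (n + 1) d j - (hankel b n *ᵥ v) j := by
    intro j
    rw [sub_mul, map_sub, ← pow_add, riesz_X_pow, hankel, mulVec_apply_eq_riesz, window]
  constructor
  · intro h j hj
    rw [key ⟨j, hj⟩, h, sub_self]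
  · intro h
    ext j
    have := key j
    rw [h j j.2] at this
    linarith

end riesz

/-! ### Atomic functionals -/

section atomic
variable {m : ℕ} {t w : Fin m → ℝ}

theorem riesz_atomicMoment (q : ℝ[X]) :
    riesz (atomicMoment t w) q = ∑ l, w l * q.eval (t l) := by
  rw [riesz_eq_sum (Nat.lt_succ_self _)]
  simp only [eval_eq_sum_range, atomicMoment, Finset.mul_sum]
  rw [Finset.sum_comm]
  exact Finset.sum_congr rfl fun l _ => Finset.sum_congr rfl fun j _ => by ring

/-- The Lagrange basis polynomials of the nodes have degree below `n`. Testing `q` against them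
isolates its value at each node, so `q` vanishes on the support. -/
theorem riesz_atomicMoment_eq_zero (ht : Function.Injective t) (hw : ∀ l, 0 < w l) {n : ℕ}
    (hmn : m ≤ n) {q : ℝ[X]} (hq : ∀ j < n, riesz (atomicMoment t w) (q * X ^ j) = 0)
    (r : ℝ[X]) : riesz (atomicMoment t w) (q * r) = 0 := by
  have hz : ∀ l, q.eval (t l) = 0 := by
    intro l
    have hinj : Set.InjOn t (Finset.univ : Finset (Fin m)) := ht.injOn
    have hd : (Lagrange.basis Finset.univ t l).natDegree < n := by
      rw [Lagrange.natDegree_basis hinj (Finset.mem_univ l)]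
      have := l.2
      simp only [Finset.card_univ, Fintype.card_fin]
      omega
    have := riesz_mul_eq_zero hq hd
    rw [riesz_atomicMoment, Finset.sum_eq_single l] at this
    · rw [eval_mul, Lagrange.eval_basis_self hinj (Finset.mem_univ l), mul_one] at this
      exact (mul_eq_zero.mp this).resolve_left (hw l).ne'
    · intro l' _ hl'
      rw [eval_mul, Lagrange.eval_basis_of_ne hl'.symm (Finset.mem_univ l')]
      simp
    · simp
  rw [riesz_atomicMoment]
  exact Finset.sum_eq_zero fun l _ => by rw [eval_mul, hz l]; simp

end atomic

/-! ### Sequences that look like moments of a measure -/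

/-- The Riesz functional of `b` is positive up to degree `2n`, and a polynomial that is null for it
generates null polynomials. -/
structure IsPositiveUpTo (b : ℕ → ℝ) (n : ℕ) : Prop where
  nonneg : ∀ q : ℝ[X], q.natDegree ≤ n → 0 ≤ riesz b (q * q)
  null : ∀ q r : ℝ[X], q.natDegree ≤ n → riesz b (q * q) = 0 →
    (q * r).natDegree ≤ 2 * n → riesz b (q * r) = 0

/-! ### Gap systems -/

/-- The monic polynomials `X ^ (N + 1) - p`, `X ^ (N + 3) - q`, `X ^ (N + 2) - r`, of which the
first two are orthogonal to the polynomials of degree at most `N`, and the last one to those of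
degree at most `N + 1`. -/
structure IsGapSystem (b : ℕ → ℝ) (N : ℕ) (p q r : ℝ[X]) : Prop where
  deg_p : p.natDegree < N + 1
  deg_q : q.natDegree < N + 1
  deg_r : r.natDegree < N + 2
  orth_p : ∀ j < N + 1, riesz b ((X ^ (N + 1) - p) * X ^ j) = 0
  orth_q : ∀ j < N + 1, riesz b ((X ^ (N + 3) - q) * X ^ j) = 0
  orth_r : ∀ j < N + 2, riesz b ((X ^ (N + 2) - r) * X ^ j) = 0

/-- The least value of `b (2N + 4)` allowed by the Hankel matrix of size `N + 3`. -/
noncomputable def lowerBound (b : ℕ → ℝ) (N : ℕ) : ℝ :=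
  mpForm (hankel b (N + 1)) (window b (N + 2) (N + 2)) (window b (N + 2) (N + 2))

/-- The value of `b (2N + 4)` for which the polynomials of degrees `N + 1` and `N + 3` of a gap
system are orthogonal. -/
noncomputable def center (b : ℕ → ℝ) (N : ℕ) : ℝ :=
  mpForm (hankel b N) (window b (N + 1) (N + 3)) (window b (N + 1) (N + 1))

/-- The Schur complement of the Hankel matrix of size `N + 1` in the one that is bordered by the
column number `d` of the infinite Hankel matrix. -/
noncomputable def schurGap (b : ℕ → ℝ) (N d : ℕ) : ℝ :=
  b (2 * d) - mpForm (hankel b N) (window b (N + 1) d) (window b (N + 1) d)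

section gap
variable {b : ℕ → ℝ} {N : ℕ} {p q r : ℝ[X]}

theorem exists_isGapSystem
    (hw : ∃ h, hankel b N *ᵥ h = window b (N + 1) (N + 1))
    (hu : ∃ g, hankel b N *ᵥ g = window b (N + 1) (N + 3))
    (hs : ∃ a, hankel b (N + 1) *ᵥ a = window b (N + 2) (N + 2)) :
    ∃ p q r, IsGapSystem b N p q r := by
  obtain ⟨h, hh⟩ := hw
  obtain ⟨g, hg⟩ := hu
  obtain ⟨a, ha⟩ := hs
  exact ⟨vecPoly h, vecPoly g, vecPoly a, natDegree_vecPoly_lt (by omega) _,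
    natDegree_vecPoly_lt (by omega) _, natDegree_vecPoly_lt (by omega) _,
    (hankel_mulVec_eq_window_iff h).mp hh, (hankel_mulVec_eq_window_iff g).mp hg,
    (hankel_mulVec_eq_window_iff a).mp ha⟩

/-- The coefficient vectors of `f` and `g` solve the two Hankel systems, so the form is the
functional at `f * X ^ e`; orthogonality allows `X ^ e` to be replaced by `X ^ e - g` in the
complement. This removes the Moore-Penrose inverse from the argument. -/
theorem mpForm_hankel_window {n d e : ℕ} {f g : ℝ[X]} (hf : f.natDegree < n + 1)
    (hg : g.natDegree < n + 1)
    (hfo : ∀ j < n + 1, riesz b ((X ^ d - f) * X ^ j) = 0)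
    (hgo : ∀ j < n + 1, riesz b ((X ^ e - g) * X ^ j) = 0) :
    mpForm (hankel b n) (window b (n + 1) d) (window b (n + 1) e) =
      b (d + e) - riesz b ((X ^ d - f) * (X ^ e - g)) := by
  rw [← vecPoly_coeff hf] at hfo
  rw [← vecPoly_coeff hg] at hgo
  have hf' := (hankel_mulVec_eq_window_iff _).mpr hfo
  have hg' := (hankel_mulVec_eq_window_iff _).mpr hgo
  have e1 := riesz_mul_eq_zero hgo hf
  have e2 : riesz b ((X ^ d - f) * X ^ e) = riesz b ((X ^ d - f) * (X ^ e - g)) := by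
    rw [vecPoly_coeff hf] at hfo
    rw [mul_sub _ _ g, map_sub, riesz_mul_eq_zero hfo hg, sub_zero]
  rw [← hf', ← hg', mpForm_mulVec (hankel_transpose b n), hg', ← e2, sub_mul, map_sub, ← pow_add,
    riesz_X_pow, dotProduct_comm, ← riesz_vecPoly_mul_X_pow, vecPoly_coeff hf]
  ring

theorem IsGapSystem.riesz_p_p (h : IsGapSystem b N p q r) :
    riesz b ((X ^ (N + 1) - p) * (X ^ (N + 1) - p)) = schurGap b N (N + 1) := by
  rw [schurGap, mpForm_hankel_window h.deg_p h.deg_p h.orth_p h.orth_p, two_mul]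
  ring

theorem IsGapSystem.riesz_q_q (h : IsGapSystem b N p q r) :
    riesz b ((X ^ (N + 3) - q) * (X ^ (N + 3) - q)) = schurGap b N (N + 3) := by
  rw [schurGap, mpForm_hankel_window h.deg_q h.deg_q h.orth_q h.orth_q, two_mul]
  ring

/-- The off-diagonal Gram entry is the only one of the three that involves the free moment `b (2N +
4)`. -/
theorem IsGapSystem.riesz_q_p (h : IsGapSystem b N p q r) :
    riesz b ((X ^ (N + 3) - q) * (X ^ (N + 1) - p)) = b (2 * N + 4) - center b N := by
  rw [center, mpForm_hankel_window h.deg_q h.deg_p h.orth_q h.orth_p,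
    show N + 3 + (N + 1) = 2 * N + 4 by ring]
  ring

theorem IsGapSystem.riesz_r_r (h : IsGapSystem b N p q r) :
    riesz b ((X ^ (N + 2) - r) * (X ^ (N + 2) - r)) = b (2 * N + 4) - lowerBound b N := by
  rw [lowerBound, mpForm_hankel_window h.deg_r h.deg_r h.orth_r h.orth_r,
    show N + 2 + (N + 2) = 2 * N + 4 by ring]
  ring

/-- The combination `e (X ^ (N + 3) - q) - f (X ^ (N + 1) - p)` that is orthogonal to the
polynomials of degree at most `N + 1`, where `e` and `f` are the values of the functional on
`(X ^ (N + 1) - p) ^ 2` and on the product of the two polynomials. -/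
theorem IsGapSystem.riesz_comb (h : IsGapSystem b N p q r) :
    ∀ j < N + 2, riesz b ((C (schurGap b N (N + 1)) * (X ^ (N + 3) - q) -
      C (b (2 * N + 4) - center b N) * (X ^ (N + 1) - p)) * X ^ j) = 0 := by
  intro j hj
  rw [sub_mul (C _ * _) (C _ * _), mul_assoc, mul_assoc, map_sub, riesz_C_mul, riesz_C_mul]
  rcases Nat.lt_succ_iff_lt_or_eq.mp hj with hj | rfl
  · rw [h.orth_q j hj, h.orth_p j hj]; ring
  · have e1 : riesz b ((X ^ (N + 3) - q) * X ^ (N + 1)) = b (2 * N + 4) - center b N := by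
      rw [← h.riesz_q_p, mul_sub _ _ p, map_sub, riesz_mul_eq_zero h.orth_q h.deg_p, sub_zero]
    have e2 : riesz b ((X ^ (N + 1) - p) * X ^ (N + 1)) = schurGap b N (N + 1) := by
      rw [← h.riesz_p_p, mul_sub _ _ p, map_sub, riesz_mul_eq_zero h.orth_p h.deg_p, sub_zero]
    rw [e1, e2]; ring

/-- The second factor on the right is the Gram determinant, so its sign is the Cauchy-Schwarz
inequality and its vanishing makes the combination null. -/
theorem IsGapSystem.riesz_comb_sq (h : IsGapSystem b N p q r) :
    riesz b ((C (schurGap b N (N + 1)) * (X ^ (N + 3) - q) -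
      C (b (2 * N + 4) - center b N) * (X ^ (N + 1) - p)) *
      (C (schurGap b N (N + 1)) * (X ^ (N + 3) - q) -
      C (b (2 * N + 4) - center b N) * (X ^ (N + 1) - p))) =
    schurGap b N (N + 1) * (schurGap b N (N + 1) * schurGap b N (N + 3) -
      (b (2 * N + 4) - center b N) ^ 2) := by
  set e := schurGap b N (N + 1) with he
  set f := b (2 * N + 4) - center b N with hf
  have : ∀ A B : ℝ[X], (C e * A - C f * B) * (C e * A - C f * B) =
      C (e * e) * (A * A) - C (2 * (e * f)) * (A * B) + C (f * f) * (B * B) := by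
    intro A B
    simp only [C_mul, map_ofNat]
    ring
  rw [this, map_add, map_sub, riesz_C_mul, riesz_C_mul, riesz_C_mul, h.riesz_q_q, h.riesz_p_p,
    h.riesz_q_p, ← he, ← hf]
  ring

end gap

/-! ### Necessary conditions -/

section necessary
variable {b : ℕ → ℝ} {N : ℕ} {p q r : ℝ[X]}

/-- A kernel vector is a null polynomial, and nullity persists after multiplication by `X ^ d`; so
the window is orthogonal to the kernel. -/
theorem IsPositiveUpTo.exists_mulVec_eq_window {m : ℕ} (hb : IsPositiveUpTo b m) {n d : ℕ}
    (hn : n ≤ m) (hd : d ≤ m) : ∃ h, hankel b n *ᵥ h = window b (n + 1) d := by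
  refine exists_mulVec_eq_of_orthogonal_ker (hankel_transpose b n) _ fun z hz => ?_
  have hdeg : (vecPoly z).natDegree < n + 1 := natDegree_vecPoly_lt (by omega) z
  rw [← riesz_vecPoly_mul_X_pow]
  apply hb.null
  · omega
  · rw [← dotProduct_mulVec_eq_riesz]
    change z ⬝ᵥ (hankel b n *ᵥ z) = 0
    rw [hz, dotProduct_zero]
  · refine natDegree_mul_le.trans ?_
    rw [natDegree_X_pow]
    omega

theorem IsPositiveUpTo.exists_isGapSystem (hb : IsPositiveUpTo b (N + 3)) :
    ∃ p q r, IsGapSystem b N p q r :=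
  CurveTMP.exists_isGapSystem (hb.exists_mulVec_eq_window (by omega) (by omega))
    (hb.exists_mulVec_eq_window (by omega) (by omega))
    (hb.exists_mulVec_eq_window (by omega) (by omega))

theorem natDegree_X_pow_sub_le {d m : ℕ} (hd : d ≤ m) {f : ℝ[X]} (hf : f.natDegree ≤ m) :
    (X ^ d - f).natDegree ≤ m := by
  refine (natDegree_sub_le _ _).trans (max_le ?_ hf)
  rwa [natDegree_X_pow]

theorem IsGapSystem.natDegree_p (h : IsGapSystem b N p q r) :
    (X ^ (N + 1) - p).natDegree ≤ N + 1 :=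
  natDegree_X_pow_sub_le (by omega) h.deg_p.le

theorem IsGapSystem.natDegree_q (h : IsGapSystem b N p q r) :
    (X ^ (N + 3) - q).natDegree ≤ N + 3 :=
  natDegree_X_pow_sub_le (by omega) (by have := h.deg_q; omega)

theorem IsGapSystem.natDegree_r (h : IsGapSystem b N p q r) :
    (X ^ (N + 2) - r).natDegree ≤ N + 2 :=
  natDegree_X_pow_sub_le (by omega) h.deg_r.le

theorem natDegree_C_mul_sub_C_mul_le {m : ℕ} {f g : ℝ[X]} (hf : f.natDegree ≤ m)
    (hg : g.natDegree ≤ m) (c d : ℝ) : (C c * f - C d * g).natDegree ≤ m :=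
  (natDegree_sub_le _ _).trans
    (max_le ((natDegree_C_mul_le _ _).trans hf) ((natDegree_C_mul_le _ _).trans hg))

theorem IsPositiveUpTo.schurGap_p_nonneg (hb : IsPositiveUpTo b (N + 3))
    (h : IsGapSystem b N p q r) : 0 ≤ schurGap b N (N + 1) := by
  rw [← h.riesz_p_p]
  exact hb.nonneg _ (h.natDegree_p.trans (by omega))

theorem IsPositiveUpTo.schurGap_q_nonneg (hb : IsPositiveUpTo b (N + 3))
    (h : IsGapSystem b N p q r) : 0 ≤ schurGap b N (N + 3) := by
  rw [← h.riesz_q_q]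
  exact hb.nonneg _ h.natDegree_q

theorem IsPositiveUpTo.lowerBound_le (hb : IsPositiveUpTo b (N + 3))
    (h : IsGapSystem b N p q r) : lowerBound b N ≤ b (2 * N + 4) := by
  rw [← sub_nonneg, ← h.riesz_r_r]
  exact hb.nonneg _ (h.natDegree_r.trans (by omega))

theorem IsPositiveUpTo.sub_center_eq_zero (hb : IsPositiveUpTo b (N + 3))
    (h : IsGapSystem b N p q r) (h0 : schurGap b N (N + 1) = 0) :
    b (2 * N + 4) - center b N = 0 := by
  rw [← h.riesz_q_p, mul_comm]
  apply hb.null _ _ (h.natDegree_p.trans (by omega))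
  · rw [h.riesz_p_p, h0]
  · refine natDegree_mul_le.trans ?_
    have := h.natDegree_p
    have := h.natDegree_q
    omega

/-- This is Cauchy-Schwarz; the degenerate case, where the Gram determinant cannot be divided out,
is settled by the null property. -/
theorem IsPositiveUpTo.sub_center_sq_le (hb : IsPositiveUpTo b (N + 3))
    (h : IsGapSystem b N p q r) :
    (b (2 * N + 4) - center b N) ^ 2 ≤ schurGap b N (N + 1) * schurGap b N (N + 3) := by
  rcases (hb.schurGap_p_nonneg h).eq_or_lt with h0 | hpos
  · rw [hb.sub_center_eq_zero h h0.symm, ← h0]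
    simp
  · have := hb.nonneg _ (natDegree_C_mul_sub_C_mul_le h.natDegree_q
      (h.natDegree_p.trans (by omega)) (schurGap b N (N + 1)) (b (2 * N + 4) - center b N))
    rw [h.riesz_comb_sq] at this
    linarith [nonneg_of_mul_nonneg_right this hpos]

/-- Divide `T` by the null polynomial `F`: the multiple of `F` contributes nothing by nullity, and
the remainder has degree at most `N`, so it is orthogonal to `T`. -/
theorem IsPositiveUpTo.riesz_mul_self_eq_zero {m : ℕ} (hb : IsPositiveUpTo b m) {F T : ℝ[X]}
    (hF : F ≠ 0) (hFd : F.natDegree < N + 2) (hFm : F.natDegree ≤ m) (hF0 : riesz b (F * F) = 0)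
    (hT : T.natDegree ≤ m) (hTo : ∀ j < N + 1, riesz b (T * X ^ j) = 0) :
    riesz b (T * T) = 0 := by
  have e : F * (T / F) + T % F = T := EuclideanDomain.div_add_mod T F
  have hrem : (T % F).natDegree < N + 1 := by
    by_cases h0 : T % F = 0
    · simp [h0]
    · have := natDegree_lt_natDegree h0 (degree_mod_lt T hF)
      omega
  have hrem' : (T % F).natDegree ≤ m := by
    by_cases h0 : T % F = 0
    · simp [h0]
    · have := natDegree_lt_natDegree h0 (degree_mod_lt T hF)
      omega
  have e2 : T * T = F * ((T / F) * T) + T * (T % F) := by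
    nth_rewrite 1 [← e]
    ring
  have e3 : F * ((T / F) * T) = (T - T % F) * T := by
    nth_rewrite 3 [← e]
    ring
  rw [e2, map_add, riesz_mul_eq_zero hTo hrem, add_zero]
  apply hb.null _ _ hFm hF0
  rw [e3]
  refine natDegree_mul_le.trans ?_
  have := (natDegree_sub_le T (T % F)).trans (max_le hT hrem')
  omega

theorem IsPositiveUpTo.posSemidef_hankel {m n : ℕ} (hb : IsPositiveUpTo b m) (hn : n ≤ m) :
    (hankel b n).PosSemidef :=
  posSemidef_iff_riesz_nonneg.mpr fun q hq => hb.nonneg q (by omega)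

theorem IsPositiveUpTo.schurGap_eq_zero_of_not_posDef (hb : IsPositiveUpTo b (N + 3))
    (h : IsGapSystem b N p q r) (hn : ¬ (hankel b (N + 1)).PosDef) :
    schurGap b N (N + 1) = 0 ∧ schurGap b N (N + 3) = 0 := by
  have : ∃ F : ℝ[X], F ≠ 0 ∧ F.natDegree < N + 2 ∧ riesz b (F * F) = 0 := by
    by_contra! hc
    refine hn (posDef_iff_riesz_pos.mpr fun q hq hd => ?_)
    exact lt_of_le_of_ne (hb.nonneg q (by omega)) (hc q hq hd).symm
  obtain ⟨F, hF, hFd, hF0⟩ := this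
  rw [← h.riesz_p_p, ← h.riesz_q_q]
  exact ⟨hb.riesz_mul_self_eq_zero hF hFd (by omega) hF0 (h.natDegree_p.trans (by omega))
    h.orth_p, hb.riesz_mul_self_eq_zero hF hFd (by omega) hF0 h.natDegree_q h.orth_q⟩

/-- If the functional is supported on at most `N + 2` points, then its moment number `2N + 4` is
both extremal values at once. -/
theorem IsPositiveUpTo.lowerBound_mem (hb : IsPositiveUpTo b (N + 3))
    (hker : ∀ f : ℝ[X], (∀ j < N + 2, riesz b (f * X ^ j) = 0) → riesz b (f * f) = 0) :
    lowerBound b N ∈ ({center b N - √(schurGap b N (N + 1) * schurGap b N (N + 3)),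
      center b N + √(schurGap b N (N + 1) * schurGap b N (N + 3))} : Set ℝ) := by
  obtain ⟨p, q, r, h⟩ := hb.exists_isGapSystem
  have hx : lowerBound b N = b (2 * N + 4) := by
    have := hker _ h.orth_r
    rw [h.riesz_r_r] at this
    linarith
  -- Outside the degenerate case the combination of `P` and `Q` lies in the kernel, so the Gram
  -- determinant is zero.
  have hsq : schurGap b N (N + 1) * schurGap b N (N + 3) =
      (b (2 * N + 4) - center b N) ^ 2 := by
    by_cases h0 : schurGap b N (N + 1) = 0
    · rw [hb.sub_center_eq_zero h h0, h0]
      simp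
    · have := hker _ h.riesz_comb
      rw [h.riesz_comb_sq] at this
      linarith [(mul_eq_zero.mp this).resolve_left h0]
  rw [hx, hsq, Real.sqrt_sq_eq_abs, Set.mem_insert_iff, Set.mem_singleton_iff]
  rcases abs_cases (b (2 * N + 4) - center b N) with ⟨h1, -⟩ | ⟨h1, -⟩ <;> rw [h1]
  · right; ring
  · left; ring

end necessary

/-! ### Sequences that agree up to the gap -/

/-- Two sequences agree at the indices at most `2N + 3` and at the index `2N + 6`. -/
def AgreeOffGap (N : ℕ) (b b' : ℕ → ℝ) : Prop := ∀ j, j ≤ 2 * N + 3 ∨ j = 2 * N + 6 → b j = b' j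

section agree
variable {b b' : ℕ → ℝ} {N : ℕ} {p q r : ℝ[X]}

theorem AgreeOffGap.symm (h : AgreeOffGap N b b') : AgreeOffGap N b' b :=
  fun j hj => (h j hj).symm

theorem AgreeOffGap.window_eq (h : AgreeOffGap N b b') {m d : ℕ} (hd : m + d ≤ 2 * N + 4) :
    window b m d = window b' m d :=
  funext fun i => h _ (Or.inl (by have := i.2; omega))

theorem AgreeOffGap.hankel_eq (h : AgreeOffGap N b b') {n : ℕ} (hn : n ≤ N + 1) :
    hankel b n = hankel b' n := by
  ext i j
  exact h _ (Or.inl (by have := i.2; have := j.2; omega))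

theorem AgreeOffGap.lowerBound_eq (h : AgreeOffGap N b b') :
    lowerBound b N = lowerBound b' N := by
  rw [lowerBound, lowerBound, h.hankel_eq le_rfl, h.window_eq (by omega)]

theorem AgreeOffGap.center_eq (h : AgreeOffGap N b b') : center b N = center b' N := by
  rw [center, center, h.hankel_eq (by omega), h.window_eq (by omega), h.window_eq (by omega)]

theorem AgreeOffGap.schurGap_p_eq (h : AgreeOffGap N b b') :
    schurGap b N (N + 1) = schurGap b' N (N + 1) := by
  rw [schurGap, schurGap, h.hankel_eq (by omega), h.window_eq (by omega), h _ (Or.inl (by omega))]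

theorem AgreeOffGap.schurGap_q_eq (h : AgreeOffGap N b b') :
    schurGap b N (N + 3) = schurGap b' N (N + 3) := by
  rw [schurGap, schurGap, h.hankel_eq (by omega), h.window_eq (by omega), h _ (Or.inr (by omega))]

theorem riesz_congr_of_lt {f : ℝ[X]} {D : ℕ} (h : ∀ j < D, b j = b' j) (hf : f.degree < D) :
    riesz b f = riesz b' f := by
  rcases eq_or_ne f 0 with rfl | h0
  · simp
  · have : f.natDegree < D := (natDegree_lt_iff_degree_lt h0).mpr hf
    exact riesz_congr (d := D - 1) (fun j hj => h j (by omega)) (by omega)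

theorem degree_mul_X_pow_lt {f : ℝ[X]} {d : ℕ} (hf : f.degree < d) {i D : ℕ} (hD : d + i ≤ D) :
    (f * X ^ i).degree < (D : WithBot ℕ) := by
  rw [degree_lt_iff_coeff_zero] at hf ⊢
  intro j hj
  rw [coeff_mul_X_pow']
  split_ifs
  · exact hf _ (by omega)
  · rfl

theorem degree_lt_of_natDegree_lt {f : ℝ[X]} {d : ℕ} (hf : f.natDegree < d) : f.degree < d :=
  degree_le_natDegree.trans_lt (by exact_mod_cast hf)

theorem degree_X_pow_sub_lt {d D : ℕ} (hd : d < D) {f : ℝ[X]} (hf : f.degree < D) :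
    (X ^ d - f).degree < (D : WithBot ℕ) :=
  (degree_sub_le _ _).trans_lt (max_lt (by rw [degree_X_pow]; exact_mod_cast hd) hf)

/-- The orthogonality relations involve only moments of index at most `2N + 3`, so filling the gap
does not disturb them. -/
theorem IsGapSystem.congr (h : IsGapSystem b N p q r) (hb : AgreeOffGap N b b') :
    IsGapSystem b' N p q r where
  deg_p := h.deg_p
  deg_q := h.deg_q
  deg_r := h.deg_r
  orth_p j hj := by
    rw [← h.orth_p j hj]
    refine riesz_congr_of_lt (D := 2 * N + 4) (fun j hj => (hb j (Or.inl (by omega))).symm)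
      (degree_mul_X_pow_lt (d := N + 2) ?_ (by omega))
    exact degree_X_pow_sub_lt (by omega) (degree_lt_of_natDegree_lt (by have := h.deg_p; omega))
  orth_q j hj := by
    rw [← h.orth_q j hj]
    refine riesz_congr_of_lt (D := 2 * N + 4) (fun j hj => (hb j (Or.inl (by omega))).symm)
      (degree_mul_X_pow_lt (d := N + 4) ?_ (by omega))
    exact degree_X_pow_sub_lt (by omega) (degree_lt_of_natDegree_lt (by have := h.deg_q; omega))
  orth_r j hj := by
    rw [← h.orth_r j hj]
    refine riesz_congr_of_lt (D := 2 * N + 4) (fun j hj => (hb j (Or.inl (by omega))).symm)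
      (degree_mul_X_pow_lt (d := N + 3) ?_ (by omega))
    exact degree_X_pow_sub_lt (by omega) (degree_lt_of_natDegree_lt (by have := h.deg_r; omega))

end agree

/-! ### Matching further moments by recursion -/

section recursion
variable {b : ℕ → ℝ} {m : ℕ} {t w : Fin m → ℝ}

theorem riesz_atomicMoment_mul_eq_zero (ht : Function.Injective t) (hw : ∀ l, 0 < w l)
    {d D : ℕ} {f : ℝ[X]} (hD : ∀ j < D, atomicMoment t w j = b j) (hdD : d + m ≤ D)
    (hf : f.degree < ((d + 1 : ℕ) : WithBot ℕ)) (hrec : ∀ j < m, riesz b (f * X ^ j) = 0) (g : ℝ[X]) :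
    riesz (atomicMoment t w) (f * g) = 0 := by
  refine riesz_atomicMoment_eq_zero ht hw le_rfl (fun j hj => ?_) g
  rw [riesz_congr_of_lt hD, hrec j hj]
  exact degree_mul_X_pow_lt hf (by omega)

/-- The polynomial `X ^ d - f` vanishes at the atoms, so both sequences obey the same recursion.
Agreement is required below `D`, not below `d + i`: when `f` has low degree, the recursion jumps
over the gap. -/
theorem atomicMoment_add_eq (ht : Function.Injective t) (hw : ∀ l, 0 < w l)
    {d D i : ℕ} {f : ℝ[X]} (hD : ∀ j < D, atomicMoment t w j = b j) (hdD : d + m ≤ D)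
    (hf : f.degree < d) (hfi : (f * X ^ i).degree < (D : WithBot ℕ))
    (hrec : ∀ j < m, riesz b ((X ^ d - f) * X ^ j) = 0)
    (hi : riesz b ((X ^ d - f) * X ^ i) = 0) : atomicMoment t w (d + i) = b (d + i) := by
  have h1 := riesz_atomicMoment_mul_eq_zero ht hw hD hdD (f := X ^ d - f)
    (degree_X_pow_sub_lt (Nat.lt_succ_self d)
      (hf.trans (by exact_mod_cast Nat.lt_succ_self d))) hrec (X ^ i)
  rw [sub_mul, map_sub, ← pow_add, riesz_X_pow, sub_eq_zero] at h1 hi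
  rw [h1, hi, riesz_congr_of_lt hD hfi]

theorem atomicMoment_eq_of_lt_add (ht : Function.Injective t) (hw : ∀ l, 0 < w l)
    {d D M : ℕ} {f : ℝ[X]} (hD : ∀ j < D, atomicMoment t w j = b j) (hdD : d + m ≤ D)
    (hf : f.degree < d) (hmM : m ≤ M) (hrec : ∀ j < M, riesz b ((X ^ d - f) * X ^ j) = 0) :
    ∀ j < d + M, atomicMoment t w j = b j := by
  intro j
  induction j using Nat.strong_induction_on with
  | _ j ih =>
    intro hj
    by_cases hjD : j < D
    · exact hD j hjD
    · obtain ⟨i, rfl⟩ := Nat.exists_eq_add_of_le (show d ≤ j by omega)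
      refine atomicMoment_add_eq ht hw (D := d + i) (fun j hj' => ih j hj' (by omega)) (by omega)
        hf (degree_mul_X_pow_lt hf le_rfl) (fun j hj' => hrec j (by omega)) (hrec i (by omega))

end recursion

/-! ### Sequences with a positive definite Hankel matrix -/

theorem exists_mulVec_eq_of_isUnit {n : ℕ} {A : Matrix (Fin n) (Fin n) ℝ} (hA : IsUnit A)
    (v : Fin n → ℝ) : ∃ g, A *ᵥ g = v :=
  Matrix.mulVec_surjective_iff_isUnit.mpr hA v

section posDef
variable {b : ℕ → ℝ} {N : ℕ}

theorem posDef_hankel_mono {m n : ℕ} (hmn : m ≤ n) (h : (hankel b n).PosDef) :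
    (hankel b m).PosDef :=
  posDef_iff_riesz_pos.mpr fun q hq hd => posDef_iff_riesz_pos.mp h q hq (by omega)

theorem exists_isGapSystem_of_posDef (h : (hankel b (N + 1)).PosDef) :
    ∃ p q r, IsGapSystem b N p q r :=
  exists_isGapSystem
    (exists_mulVec_eq_of_isUnit (posDef_hankel_mono (by omega) h).isUnit _)
    (exists_mulVec_eq_of_isUnit (posDef_hankel_mono (by omega) h).isUnit _)
    (exists_mulVec_eq_of_isUnit h.isUnit _)

theorem IsGapSystem.schurGap_p_pos {p q r : ℝ[X]} (hG : IsGapSystem b N p q r)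
    (h : (hankel b (N + 1)).PosDef) : 0 < schurGap b N (N + 1) := by
  rw [← hG.riesz_p_p]
  refine posDef_iff_riesz_pos.mp h _ ?_ (by have := hG.natDegree_p; omega)
  exact (monic_X_pow_sub (degree_lt_of_natDegree_lt hG.deg_p)).ne_zero

/-- The gap can be filled such that a monic polynomial of degree `N + 3`, without term of degree
`N + 2`, is orthogonal to all polynomials of degree at most `N + 3`. -/
theorem exists_agreeOffGap (h : (hankel b (N + 1)).PosDef) {x : ℝ}
    (hx : (x - center b N) ^ 2 = schurGap b N (N + 1) * schurGap b N (N + 3)) :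
    ∃ (b' : ℕ → ℝ) (f : ℝ[X]), AgreeOffGap N b b' ∧ b' (2 * N + 4) = x ∧
      f.degree < ((N + 2 : ℕ) : WithBot ℕ) ∧
      ∀ j < N + 4, riesz b' ((X ^ (N + 3) - f) * X ^ j) = 0 := by
  obtain ⟨p, q, r, hG⟩ := exists_isGapSystem_of_posDef h
  have he := hG.schurGap_p_pos h
  -- Chosen so that `X ^ (N + 3) - f` is the combination of `Q` and `P` divided by its leading
  -- coefficient.
  set f : ℝ[X] := q + C ((x - center b N) / schurGap b N (N + 1)) * (X ^ (N + 1) - p) with hf_def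
  have hfdeg : f.natDegree < N + 2 := by
    refine Nat.lt_succ_of_le ((natDegree_add_le _ _).trans (max_le hG.deg_q.le ?_))
    exact (natDegree_C_mul_le _ _).trans hG.natDegree_p
  -- The value at `2N + 5` enforces orthogonality to `X ^ (N + 2)`. It is not circular: `f * X ^ (N
  -- + 2)` has degree at most `2N + 3`.
  set b' : ℕ → ℝ := fun j => if j = 2 * N + 4 then x else
    if j = 2 * N + 5 then riesz b (f * X ^ (N + 2)) else b j with hb'
  have hagree : AgreeOffGap N b b' := by
    intro j hj
    rw [hb']
    simp only
    rw [if_neg (by omega), if_neg (by omega)]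
  have hx' : b' (2 * N + 4) = x := by simp [hb']
  have hG' := hG.congr hagree
  rw [hagree.schurGap_p_eq] at he
  have hK : C (schurGap b' N (N + 1)) * (X ^ (N + 3) - f) =
      C (schurGap b' N (N + 1)) * (X ^ (N + 3) - q) -
      C (b' (2 * N + 4) - center b' N) * (X ^ (N + 1) - p) := by
    have : C (schurGap b' N (N + 1)) * C ((x - center b N) / schurGap b N (N + 1)) =
        C (b' (2 * N + 4) - center b' N) := by
      rw [← C_mul, hagree.schurGap_p_eq, mul_div_cancel₀ _ he.ne', hagree.center_eq, hx']
    rw [← this, hf_def]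
    ring
  have ho : ∀ j < N + 2, riesz b' ((X ^ (N + 3) - f) * X ^ j) = 0 := by
    intro j hj
    have := hG'.riesz_comb j hj
    rw [← hK, mul_assoc, riesz_C_mul] at this
    exact (mul_eq_zero.mp this).resolve_left he.ne'
  refine ⟨b', f, hagree, hx', degree_lt_of_natDegree_lt hfdeg, fun j hj => ?_⟩
  rcases lt_trichotomy j (N + 2) with hj' | rfl | hj'
  · exact ho j hj'
  · have h1 : riesz b' (f * X ^ (N + 2)) = riesz b (f * X ^ (N + 2)) :=
      (riesz_congr_of_lt (D := 2 * N + 4) (fun j hj => hagree j (Or.inl (by omega)))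
        (degree_mul_X_pow_lt (degree_lt_of_natDegree_lt hfdeg) (by omega))).symm
    rw [sub_mul, map_sub, ← pow_add, riesz_X_pow, h1, hb']
    simp only
    rw [if_neg (by omega), if_pos (by omega), sub_self]
  · obtain rfl : j = N + 3 := by omega
    -- The equation for `x` makes the Gram determinant vanish, so the polynomial is null;
    -- orthogonality to `X ^ (N + 3)` follows.
    have h1 := hG'.riesz_comb_sq
    rw [← hK, hx', ← hagree.center_eq, hx, hagree.schurGap_p_eq, hagree.schurGap_q_eq, sub_self,
      mul_zero, mul_assoc, riesz_C_mul, mul_left_comm, riesz_C_mul] at h1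
    have h2 := (mul_eq_zero.mp ((mul_eq_zero.mp h1).resolve_left he.ne')).resolve_left he.ne'
    rw [mul_sub _ _ f, map_sub, riesz_mul_eq_zero ho hfdeg, sub_zero] at h2
    exact h2

/-- Splitting off the multiple of `R` that carries the top coefficient is an orthogonal
decomposition, and `lowerBound` is exactly where the square norm of `R` becomes zero. -/
theorem posDef_hankel_succ_of_lowerBound_lt (h : (hankel b (N + 1)).PosDef)
    (hlt : lowerBound b N < b (2 * N + 4)) : (hankel b (N + 2)).PosDef := by
  obtain ⟨p, q, r, hG⟩ := exists_isGapSystem_of_posDef h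
  refine posDef_iff_riesz_pos.mpr fun f hf hd => ?_
  by_cases hc : f.coeff (N + 2) = 0
  · refine posDef_iff_riesz_pos.mp h f hf (lt_of_le_of_ne (Nat.lt_succ_iff.mp hd) fun he => hf ?_)
    rw [← leadingCoeff_eq_zero, leadingCoeff, he, hc]
  · set c := f.coeff (N + 2)
    set s : ℝ[X] := f - C c * (X ^ (N + 2) - r) with hs
    have hsd : s.degree < ((N + 2 : ℕ) : WithBot ℕ) := by
      rw [degree_lt_iff_coeff_zero]
      intro j hj
      rw [hs, coeff_sub, coeff_C_mul, coeff_sub, coeff_X_pow,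
        coeff_eq_zero_of_natDegree_lt (hG.deg_r.trans_le hj)]
      rcases hj.eq_or_lt with rfl | hj'
      · simp [c]
      · rw [if_neg hj'.ne', coeff_eq_zero_of_natDegree_lt (by omega)]
        simp
    have hsn : s.natDegree < N + 2 := by
      by_cases h0 : s = 0
      · simp [h0]
      · exact (natDegree_lt_iff_degree_lt h0).mpr hsd
    have hss : 0 ≤ riesz b (s * s) := posSemidef_iff_riesz_nonneg.mp h.posSemidef s hsn
    have hff : f * f = C (c * c) * ((X ^ (N + 2) - r) * (X ^ (N + 2) - r)) +
        C (2 * c) * ((X ^ (N + 2) - r) * s) + s * s := by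
      have : f = C c * (X ^ (N + 2) - r) + s := by rw [hs]; ring
      nth_rewrite 1 2 [this]
      simp only [C_mul, map_ofNat]
      ring
    rw [hff, map_add, map_add, riesz_C_mul, riesz_C_mul, riesz_mul_eq_zero hG.orth_r hsn,
      hG.riesz_r_r]
    have : 0 < c * c * (b (2 * N + 4) - lowerBound b N) :=
      mul_pos (mul_self_pos.mpr hc) (sub_pos.mpr hlt)
    linarith

/-- With the larger root in the gap, `N + 3` Gauss nodes match all moments up to `2N + 5`; the null
polynomial of degree `N + 3` supplies `2N + 6`. -/
theorem exists_atoms_of_lowerBound_lt (h : (hankel b (N + 1)).PosDef)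
    (h0 : 0 ≤ schurGap b N (N + 1) * schurGap b N (N + 3))
    (hlt : lowerBound b N < center b N + √(schurGap b N (N + 1) * schurGap b N (N + 3))) :
    ∃ t w : Fin (N + 2 + 1) → ℝ, Function.Injective t ∧ (∀ l, 0 < w l) ∧
      AgreeOffGap N (atomicMoment t w) b := by
  obtain ⟨b', f, hagree, hx, hf, hrec⟩ := exists_agreeOffGap h
    (x := center b N + √(schurGap b N (N + 1) * schurGap b N (N + 3)))
    (by rw [add_sub_cancel_left, Real.sq_sqrt h0])
  have h' : (hankel b' (N + 1)).PosDef := by rwa [← hagree.hankel_eq le_rfl]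
  have hpd := posDef_hankel_succ_of_lowerBound_lt h' (by rwa [← hagree.lowerBound_eq, hx])
  obtain ⟨t, w, ht, hw, hm⟩ := exists_gauss_quadrature b' (N + 2 + 1) hpd
  refine ⟨t, w, ht, hw, fun j hj => ?_⟩
  rw [hagree j hj]
  rcases hj with hj | rfl
  · exact hm j (by omega)
  · rw [show 2 * N + 6 = N + 3 + (N + 3) by ring]
    exact atomicMoment_add_eq ht hw (i := N + 3) hm (by omega)
      (hf.trans (by exact_mod_cast Nat.lt_succ_self _))
      (degree_mul_X_pow_lt hf (by omega)) (fun j hj => hrec j (by omega)) (hrec _ (by omega))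

/-- With `lowerBound` in the gap, `R` is null as well. The `N + 2` Gauss nodes match up to `2N + 3`,
`R` extends this to `2N + 4`, and the polynomial of degree `N + 3`, having no term of degree `N +
2`, jumps over `2N + 5`. -/
theorem exists_atoms_of_lowerBound_mem (h : (hankel b (N + 1)).PosDef)
    (h0 : 0 ≤ schurGap b N (N + 1) * schurGap b N (N + 3))
    (hmem : lowerBound b N ∈ ({center b N - √(schurGap b N (N + 1) * schurGap b N (N + 3)),
      center b N + √(schurGap b N (N + 1) * schurGap b N (N + 3))} : Set ℝ)) :
    ∃ t w : Fin (N + 2) → ℝ, Function.Injective t ∧ (∀ l, 0 < w l) ∧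
      AgreeOffGap N (atomicMoment t w) b := by
  obtain ⟨b', f, hagree, hx, hf, hrec⟩ := exists_agreeOffGap h (x := lowerBound b N) (by
    rcases hmem with hm | hm <;> rw [hm]
    · rw [sub_sub_cancel_left, neg_sq, Real.sq_sqrt h0]
    · rw [add_sub_cancel_left, Real.sq_sqrt h0])
  have h' : (hankel b' (N + 1)).PosDef := by rwa [← hagree.hankel_eq le_rfl]
  obtain ⟨p, q, r, hG⟩ := exists_isGapSystem_of_posDef h'
  obtain ⟨t, w, ht, hw, hm⟩ := exists_gauss_quadrature b' (N + 2) h'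
  have hr := degree_lt_of_natDegree_lt hG.deg_r
  have hrr : riesz b' ((X ^ (N + 2) - r) * X ^ (N + 2)) = 0 := by
    have := hG.riesz_r_r
    rwa [hx, hagree.lowerBound_eq, sub_self, mul_sub _ _ r, map_sub,
      riesz_mul_eq_zero hG.orth_r hG.deg_r, sub_zero] at this
  have hm' := atomicMoment_eq_of_lt_add ht hw (M := N + 3) hm (by omega) hr (by omega)
    (fun j hj => by
      rcases Nat.lt_succ_iff_lt_or_eq.mp hj with hj | rfl
      · exact hG.orth_r j hj
      · exact hrr)
  refine ⟨t, w, ht, hw, fun j hj => ?_⟩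
  rw [hagree j hj]
  rcases hj with hj | rfl
  · exact hm j (by omega)
  · rw [show 2 * N + 6 = N + 3 + (N + 3) by ring]
    exact atomicMoment_add_eq ht hw (i := N + 3) hm' (by omega)
      (hf.trans (by exact_mod_cast Nat.lt_succ_self _))
      (degree_mul_X_pow_lt hf (by omega)) (fun j hj => hrec j (by omega)) (hrec _ (by omega))

end posDef

/-! ### Sequences with a singular positive semidefinite Hankel matrix -/

section singular
variable {b : ℕ → ℝ} {n N : ℕ}

theorem col_mem_span_iff {i : ℕ} (hi : i < n + 1) :
    (hankel b n).col ⟨i, hi⟩ ∈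
      Submodule.span ℝ ((hankel b n).col '' {j : Fin (n + 1) | (j : ℕ) < i}) ↔
    ∃ f : ℝ[X], f.degree < (i : WithBot ℕ) ∧ ∀ j < n + 1, riesz b ((X ^ i - f) * X ^ j) = 0 := by
  have hcol : (hankel b n).col ⟨i, hi⟩ = window b (n + 1) i := by
    ext j
    simp [hankel, window, add_comm]
  have hlin : ∀ l : Fin (n + 1) →₀ ℝ,
      Finsupp.linearCombination ℝ (hankel b n).col l = hankel b n *ᵥ l := by
    intro l
    rw [Finsupp.linearCombination_apply, Finsupp.sum_fintype _ _ (by simp)]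
    ext j
    simp [Matrix.mulVec, dotProduct, mul_comm]
  rw [Finsupp.mem_span_image_iff_linearCombination, hcol]
  constructor
  · rintro ⟨l, hl, hl'⟩
    rw [hlin] at hl'
    refine ⟨vecPoly l, ?_, (hankel_mulVec_eq_window_iff _).mp hl'⟩
    rw [degree_lt_iff_coeff_zero]
    intro j hj
    by_cases hjn : j < n + 1
    · rw [coeff_vecPoly l ⟨j, hjn⟩]
      by_contra hne
      have := hl (Finsupp.mem_support_iff.mpr hne)
      simp only [Set.mem_ofPred_eq] at this
      omega
    · exact coeff_eq_zero_of_natDegree_lt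
        ((natDegree_vecPoly_lt (by omega) _).trans_le (not_lt.mp hjn))
  · rintro ⟨f, hf, hf'⟩
    have hfn : f.natDegree < n + 1 := by
      by_cases h0 : f = 0
      · simp [h0]
      · have := (natDegree_lt_iff_degree_lt h0).mpr hf
        omega
    rw [← vecPoly_coeff hfn, ← hankel_mulVec_eq_window_iff] at hf'
    refine ⟨Finsupp.equivFunOnFinite.symm (fun j : Fin (n + 1) => f.coeff j), ?_, ?_⟩
    · intro j hj
      by_contra hne
      rw [degree_lt_iff_coeff_zero] at hf
      simp only [Set.mem_ofPred_eq, not_lt] at hne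
      have := hf j hne
      simp [this] at hj
    · rw [hlin]
      exact hf'

/-- A positive semidefinite singular Hankel matrix of rank `r` in the sense of sequences has a
monic null polynomial of degree `r`, and no null polynomial of smaller degree. -/
theorem exists_null_of_not_posDef (h : (hankel b n).PosSemidef) (hn : ¬ (hankel b n).PosDef) :
    seqRank b n < n + 1 ∧
    (∃ f : ℝ[X], f.degree < (seqRank b n : WithBot ℕ) ∧
      ∀ j < n + 1, riesz b ((X ^ seqRank b n - f) * X ^ j) = 0) ∧
    (Matrix.of fun i j : Fin (seqRank b n) => b (i + j)).PosDef := by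
  set S := {i : ℕ | ∃ h : i < n + 1, (hankel b n).col ⟨i, h⟩ ∈
    Submodule.span ℝ ((hankel b n).col '' {j : Fin (n + 1) | (j : ℕ) < i})}
  have hrank : seqRank b n = sInf S := by
    rw [seqRank, if_neg]
    rwa [← h.posDef_iff_isUnit]
  -- In a positive semidefinite form an isotropic vector lies in the kernel; made monic, it
  -- expresses a column through the earlier ones.
  have hnull : ∀ q : ℝ[X], q ≠ 0 → q.natDegree < n + 1 → ¬ 0 < riesz b (q * q) →
      q.natDegree ∈ S := by
    intro q hq hd hpos
    have h0 : riesz b (q * q) = 0 :=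
      le_antisymm (not_lt.mp hpos) (posSemidef_iff_riesz_nonneg.mp h q hd)
    refine ⟨hd, (col_mem_span_iff hd).mpr ⟨X ^ q.natDegree - C q.leadingCoeff⁻¹ * q, ?_, ?_⟩⟩
    · have hm : (C q.leadingCoeff⁻¹ * q).Monic := by
        rw [mul_comm]
        exact monic_mul_leadingCoeff_inv hq
      have hdq : (C q.leadingCoeff⁻¹ * q).degree = q.natDegree := by
        rw [degree_C_mul (inv_ne_zero (leadingCoeff_ne_zero.mpr hq)), degree_eq_natDegree hq]
      have := degree_sub_lt_left (p := (X : ℝ[X]) ^ q.natDegree) (q := C q.leadingCoeff⁻¹ * q)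
        (by rw [degree_X_pow, hdq]) (pow_ne_zero _ X_ne_zero)
        (by rw [hm.leadingCoeff, (monic_X_pow _).leadingCoeff])
      rwa [degree_X_pow] at this
    · intro j hj
      have hv := (h.dotProduct_mulVec_zero_iff (fun i : Fin (n + 1) => q.coeff i)).mp (by
        rw [star_trivial]
        exact (dotProduct_mulVec_eq_riesz _ _).trans (by rw [vecPoly_coeff hd, h0]))
      have := congrFun hv ⟨j, hj⟩
      rw [hankel, mulVec_apply_eq_riesz, vecPoly_coeff hd] at this
      rw [sub_sub_cancel, mul_assoc, riesz_C_mul, this, Pi.zero_apply, mul_zero]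
  have hne : S.Nonempty := by
    obtain ⟨q, hq, hd, hle⟩ : ∃ q : ℝ[X], q ≠ 0 ∧ q.natDegree < n + 1 ∧ riesz b (q * q) ≤ 0 := by
      by_contra! hall
      exact hn (posDef_iff_riesz_pos.mpr hall)
    exact ⟨_, hnull q hq hd hle.not_gt⟩
  obtain ⟨hlt, hmem⟩ := Nat.sInf_mem hne
  rw [hrank]
  refine ⟨hlt, (col_mem_span_iff hlt).mp hmem, ?_⟩
  rw [posDef_iff_riesz_pos]
  intro q hq hd
  by_contra hpos
  exact absurd (Nat.sInf_le (hnull q hq (hd.trans hlt) hpos)) (not_le.mpr hd)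

theorem seqRank_le (h : (hankel b n).PosSemidef) : seqRank b n ≤ n + 1 := by
  by_cases hpd : (hankel b n).PosDef
  · rw [seqRank, if_pos hpd.isUnit]
  · exact (exists_null_of_not_posDef h hpd).1.le

theorem seqRank_of_posDef (h : (hankel b n).PosDef) : seqRank b n = n + 1 := by
  rw [seqRank, if_pos h.isUnit]

/-- Gauss quadrature for the largest nonsingular leading block is extended by four recursions in
turn: the null polynomial, `P`, `R` and `Q` give agreement below `seqRank + N + 2`, `2N + 3`, `2N +
4`, and finally at `2N + 6`. The vanishing Schur complements add the one orthogonality relation that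
`P` and `Q` each need. -/
theorem exists_atoms_of_not_posDef (h : (hankel b (N + 1)).PosSemidef)
    (hn : ¬ (hankel b (N + 1)).PosDef) {p q r : ℝ[X]} (hG : IsGapSystem b N p q r)
    (hp : schurGap b N (N + 1) = 0) (hq : schurGap b N (N + 3) = 0) :
    ∃ t w : Fin (seqRank b (N + 1)) → ℝ, Function.Injective t ∧ (∀ l, 0 < w l) ∧
      AgreeOffGap N (atomicMoment t w) b := by
  obtain ⟨hlt, ⟨f, hf, hfo⟩, hpd⟩ := exists_null_of_not_posDef h hn
  obtain ⟨t, w, ht, hw, hm⟩ := exists_gauss_quadrature b _ hpd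
  have h1 := atomicMoment_eq_of_lt_add ht hw hm (by omega) hf (by omega) hfo
  have hpo : ∀ j < N + 2, riesz b ((X ^ (N + 1) - p) * X ^ j) = 0 := by
    intro j hj
    rcases Nat.lt_succ_iff_lt_or_eq.mp hj with hj | rfl
    · exact hG.orth_p j hj
    · have := hG.riesz_p_p
      rwa [hp, mul_sub _ _ p, map_sub, riesz_mul_eq_zero hG.orth_p hG.deg_p, sub_zero] at this
  have hqo : riesz b ((X ^ (N + 3) - q) * X ^ (N + 3)) = 0 := by
    have := hG.riesz_q_q
    rwa [hq, mul_sub _ _ q, map_sub, riesz_mul_eq_zero hG.orth_q hG.deg_q, sub_zero] at this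
  have h2 := atomicMoment_eq_of_lt_add ht hw h1 (by omega) (degree_lt_of_natDegree_lt hG.deg_p)
    (by omega) hpo
  have h3 := atomicMoment_eq_of_lt_add ht hw h2 (by omega) (degree_lt_of_natDegree_lt hG.deg_r)
    (by omega) hG.orth_r
  refine ⟨t, w, ht, hw, fun j hj => ?_⟩
  rcases hj with hj | rfl
  · exact h3 j (by omega)
  · rw [show 2 * N + 6 = N + 3 + (N + 3) by ring]
    have hqd := degree_lt_of_natDegree_lt hG.deg_q
    exact atomicMoment_add_eq ht hw (i := N + 3) h3 (by omega)
      (hqd.trans (by exact_mod_cast (by omega : N + 1 < N + 3)))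
      (degree_mul_X_pow_lt hqd (by omega)) (fun j hj => hG.orth_q j (by omega)) hqo

end singular

/-! ### Moments of measures -/

section measure
variable {μ : Measure (ℝ × ℝ)}

/-- A polynomial whose square has zero integral vanishes almost everywhere, and so do its multiples.
-/
theorem isPositiveUpTo_integral {n : ℕ}
    (hint : ∀ j ≤ 2 * n, Integrable (fun z : ℝ × ℝ => z.1 ^ j) μ) :
    IsPositiveUpTo (fun j => ∫ z : ℝ × ℝ, z.1 ^ j ∂μ) n := by
  have key : ∀ q : ℝ[X], q.natDegree ≤ 2 * n →
      Integrable (fun z : ℝ × ℝ => q.eval z.1) μ ∧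
      riesz (fun j => ∫ z : ℝ × ℝ, z.1 ^ j ∂μ) q = ∫ z : ℝ × ℝ, q.eval z.1 ∂μ := by
    intro q hq
    have hi : ∀ j ∈ Finset.range (q.natDegree + 1),
        Integrable (fun z : ℝ × ℝ => q.coeff j * z.1 ^ j) μ := fun j hj =>
      (hint j (by have := Finset.mem_range.mp hj; omega)).const_mul _
    rw [riesz_eq_sum (Nat.lt_succ_self _)]
    simp only [eval_eq_sum_range]
    refine ⟨integrable_finsetSum _ hi, ?_⟩
    rw [integral_finsetSum _ hi]
    exact Finset.sum_congr rfl fun j _ => (integral_const_mul _ _).symm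
  have hsq : ∀ q : ℝ[X], q.natDegree ≤ n → (q * q).natDegree ≤ 2 * n := fun q hq =>
    natDegree_mul_le.trans (by omega)
  refine ⟨fun q hq => ?_, fun q r hq h0 hqr => ?_⟩
  · rw [(key _ (hsq q hq)).2]
    exact integral_nonneg fun z => by
      simp only [eval_mul]
      exact mul_self_nonneg _
  · obtain ⟨hi, he⟩ := key _ (hsq q hq)
    rw [he, integral_eq_zero_iff_of_nonneg (fun z => by
      simp only [eval_mul]
      exact mul_self_nonneg _) hi] at h0
    rw [(key _ hqr).2]
    apply integral_eq_zero_of_ae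
    filter_upwards [h0] with z hz
    simp only [eval_mul, Pi.zero_apply, mul_self_eq_zero] at hz ⊢
    rw [hz, zero_mul]

theorem integrable_pow_of_le {m j : ℕ} (hj : j ≤ 2 * m)
    (h0 : Integrable (fun _ : ℝ × ℝ => (1 : ℝ)) μ)
    (hm : Integrable (fun z : ℝ × ℝ => z.1 ^ (2 * m)) μ) :
    Integrable (fun z : ℝ × ℝ => z.1 ^ j) μ := by
  refine Integrable.mono' (h0.add hm) (by fun_prop) (Filter.Eventually.of_forall fun z => ?_)
  simp only [Pi.add_apply, Real.norm_eq_abs, abs_pow]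
  rw [pow_mul, ← sq_abs, ← pow_mul]
  rcases le_total |z.1| 1 with h | h
  · have := pow_le_one₀ (n := j) (abs_nonneg z.1) h
    have := pow_nonneg (abs_nonneg z.1) (2 * m)
    linarith
  · have := pow_le_pow_right₀ h hj
    linarith

theorem integrable_and_integral_sum_dirac {ι : Type*} [Fintype ι] (z : ι → ℝ × ℝ) (c : ι → ℝ)
    (hc : ∀ l, 0 < c l) (f : ℝ × ℝ → ℝ) :
    Integrable f (∑ l, ENNReal.ofReal (c l) • Measure.dirac (z l)) ∧
      ∫ x, f x ∂(∑ l, ENNReal.ofReal (c l) • Measure.dirac (z l)) = ∑ l, c l * f (z l) := by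
  have hi : ∀ l ∈ Finset.univ,
      Integrable f (ENNReal.ofReal (c l) • Measure.dirac (z l)) := fun l _ =>
    (integrable_dirac (by simp)).smul_measure ENNReal.ofReal_ne_top
  refine ⟨integrable_finsetSum_measure.mpr hi, ?_⟩
  rw [integral_finsetSum_measure hi]
  refine Finset.sum_congr rfl fun l _ => ?_
  rw [integral_smul_measure, integral_dirac, ENNReal.toReal_ofReal (hc l).le, smul_eq_mul]

end measure

/-! ### The relations between the moments on the curve -/

section curve
variable {β : ℕ → ℕ → ℝ} {k : ℕ}

theorem colEval_sub (p q : MvPolynomial (Fin 2) ℝ) :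
    colEval β k (p - q) = colEval β k p - colEval β k q := by
  rw [colEval, colEval, colEval, ← Matrix.mulVec_sub]
  congr 1

theorem colEval_X_pow_mul_X_pow {i j : ℕ} (h : i + j ≤ k) (r : MonIdx k) :
    colEval β k (MvPolynomial.X 0 ^ i * MvPolynomial.X 1 ^ j) r = β (r.1.1 + i) (r.1.2 + j) := by
  classical
  have hmem : (i, j) ∈ (Finset.range (k + 1) ×ˢ Finset.range (k + 1)).filter
      (fun p => p.1 + p.2 ≤ k) := by
    simp only [Finset.mem_filter, Finset.mem_product, Finset.mem_range]
    omega
  have hmon : (MvPolynomial.X 0 ^ i * MvPolynomial.X 1 ^ j : MvPolynomial (Fin 2) ℝ) =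
      MvPolynomial.monomial (Finsupp.single 0 i + Finsupp.single 1 j) 1 := by
    rw [MvPolynomial.X_pow_eq_monomial, MvPolynomial.X_pow_eq_monomial,
      MvPolynomial.monomial_mul, one_mul]
  have hvec : (fun c : MonIdx k =>
      (MvPolynomial.X 0 ^ i * MvPolynomial.X 1 ^ j : MvPolynomial (Fin 2) ℝ).coeff
        (Finsupp.single 0 c.1.1 + Finsupp.single 1 c.1.2)) =
      Pi.single (⟨(i, j), hmem⟩ : MonIdx k) 1 := by
    ext c
    rw [hmon, MvPolynomial.coeff_monomial, Pi.single_apply]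
    refine if_congr ⟨fun h => ?_, fun h => ?_⟩ rfl rfl
    · have h0 := DFunLike.congr_fun h 0
      have h1 := DFunLike.congr_fun h 1
      simp at h0 h1
      exact Subtype.ext (Prod.ext h0.symm h1.symm)
    · rw [h]
  rw [colEval, hvec, Matrix.mulVec_single_one]
  rfl

/-- The relations between the moments of degree at most `2k` on the curve `y = x ^ 4`. -/
def MomentRelations (β : ℕ → ℕ → ℝ) (k : ℕ) : Prop :=
  ∀ i j, i + 4 + j ≤ 2 * k → β (i + 4) j = β i (j + 1)

theorem colEval_curve_mul {i j : ℕ} (h : i + 4 + j ≤ k) (r : MonIdx k) :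
    colEval β k ((MvPolynomial.X 1 - MvPolynomial.X 0 ^ 4) *
      (MvPolynomial.X 0 ^ i * MvPolynomial.X 1 ^ j)) r =
      β (r.1.1 + i) (r.1.2 + (j + 1)) - β (r.1.1 + (i + 4)) (r.1.2 + j) := by
  have e : ((MvPolynomial.X 1 - MvPolynomial.X 0 ^ 4) *
      (MvPolynomial.X 0 ^ i * MvPolynomial.X 1 ^ j) : MvPolynomial (Fin 2) ℝ) =
      MvPolynomial.X 0 ^ i * MvPolynomial.X 1 ^ (j + 1) -
      MvPolynomial.X 0 ^ (i + 4) * MvPolynomial.X 1 ^ j := by ring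
  rw [e, colEval_sub, Pi.sub_apply, colEval_X_pow_mul_X_pow (by omega),
    colEval_X_pow_mul_X_pow (by omega)]

theorem MomentRelations.curveRelations (h : MomentRelations β k) : CurveRelations β k := by
  refine ⟨fun hk => ?_, ?_, ?_⟩
  · ext r
    have hr := r.2
    simp only [Finset.mem_filter] at hr
    have e := colEval_curve_mul (β := β) (i := 0) (j := 0) (by omega) r
    rw [pow_zero, pow_zero, mul_one, mul_one] at e
    rw [e, Pi.zero_apply, ← h _ _ (by omega)]
    simp
  · rintro rfl
    exact ⟨(h 0 0 (by omega)).symm, (h 1 0 (by omega)).symm, (h 2 0 (by omega)).symm,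
      (h 0 1 (by omega)).symm, (h 1 1 (by omega)).symm, (h 0 2 (by omega)).symm⟩
  · rintro rfl
    exact (h 0 0 (by omega)).symm

/-- For `k ≥ 4`, recursive generation multiplies the column relation by a monomial, and the choice
of row multiplies it by a second one; together they reach degree `2k`. -/
theorem CurveRelations.momentRelations (hk : 1 ≤ k) (h : CurveRelations β k)
    (hrg : RecursivelyGenerated β k) : MomentRelations β k := by
  intro i j hij
  obtain rfl | rfl | rfl | hk4 : k = 1 ∨ k = 2 ∨ k = 3 ∨ 4 ≤ k := by omega
  · omega
  · obtain ⟨rfl, rfl⟩ : i = 0 ∧ j = 0 := by omega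
    exact (h.2.2 rfl).symm
  · obtain ⟨h1, h2, h3, h4, h5, h6⟩ := h.2.1 rfl
    have : (i = 0 ∧ j = 0) ∨ (i = 1 ∧ j = 0) ∨ (i = 2 ∧ j = 0) ∨ (i = 0 ∧ j = 1) ∨
        (i = 1 ∧ j = 1) ∨ (i = 0 ∧ j = 2) := by omega
    rcases this with ⟨rfl, rfl⟩ | ⟨rfl, rfl⟩ | ⟨rfl, rfl⟩ | ⟨rfl, rfl⟩ | ⟨rfl, rfl⟩ | ⟨rfl, rfl⟩
    exacts [h1.symm, h2.symm, h3.symm, h4.symm, h5.symm, h6.symm]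
  -- The column monomial greedily takes up to `k - 4` of the total degree; the rest goes to the row.
  · obtain ⟨i₁, j₁, i₂, j₂, rfl, rfl, h1, h2⟩ : ∃ i₁ j₁ i₂ j₂, i = i₂ + i₁ ∧ j = j₂ + j₁ ∧
        i₁ + 4 + j₁ ≤ k ∧ i₂ + j₂ ≤ k :=
      ⟨min i (k - 4), min j (k - 4 - min i (k - 4)), i - min i (k - 4),
        j - min j (k - 4 - min i (k - 4)), by omega, by omega, by omega, by omega⟩
    have hX : ∀ (l : Fin 2) (m : ℕ),
        (MvPolynomial.X l ^ m : MvPolynomial (Fin 2) ℝ).totalDegree ≤ m := fun l m =>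
      (MvPolynomial.totalDegree_X_pow l m).le
    have hc : (MvPolynomial.X 1 - MvPolynomial.X 0 ^ 4 : MvPolynomial (Fin 2) ℝ).totalDegree
        ≤ 4 := by
      refine (MvPolynomial.totalDegree_sub _ _).trans (max_le ?_ (hX 0 4))
      rw [MvPolynomial.totalDegree_X]
      omega
    have hm : (MvPolynomial.X 0 ^ i₁ * MvPolynomial.X 1 ^ j₁ :
        MvPolynomial (Fin 2) ℝ).totalDegree ≤ i₁ + j₁ :=
      (MvPolynomial.totalDegree_mul _ _).trans (add_le_add (hX 0 i₁) (hX 1 j₁))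
    have h0 := hrg _ _ (hc.trans hk4) (hm.trans (by omega))
      ((MvPolynomial.totalDegree_mul _ _).trans ((add_le_add hc hm).trans (by omega))) (h.1 hk4)
    have h3 := congrFun h0 ⟨(i₂, j₂), by
      simp only [Finset.mem_filter, Finset.mem_product, Finset.mem_range]
      omega⟩
    rw [colEval_curve_mul h1] at h3
    simp only [Pi.zero_apply] at h3
    rw [add_assoc i₂, add_assoc j₂]
    linarith

/-- Trading `x ^ 4` for `y` lowers the degree, so every intermediate moment stays within the data.
-/
theorem MomentRelations.eq_uSeq (h : MomentRelations β k) (i : ℕ) :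
    ∀ j, i + j ≤ 2 * k → β i j = uSeq β (i + 4 * j) := by
  induction i using Nat.strong_induction_on with
  | _ i ih =>
    intro j hij
    by_cases hi : i < 4
    · rw [uSeq]
      congr 1 <;> omega
    · obtain ⟨i, rfl⟩ := Nat.exists_eq_add_of_le' (not_lt.mp hi)
      rw [h i j (by omega), ih i (by omega) (j + 1) (by omega)]
      congr 1
      ring

end curve

/-! ### Transfer between the curve and the line -/

section transfer
variable {β : ℕ → ℕ → ℝ} {k : ℕ} {μ : Measure (ℝ × ℝ)}

theorem IsRepresenting.ae_eq (h : IsRepresenting β k μ) : ∀ᵐ z ∂μ, z.2 = z.1 ^ 4 := by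
  rw [ae_iff]
  exact h.1

theorem IsRepresenting.momentRelations (h : IsRepresenting β k μ) : MomentRelations β k := by
  intro i j hij
  rw [← (h.2 (i + 4) j (Or.inl hij)).2, ← (h.2 i (j + 1) (Or.inl (by omega))).2]
  refine integral_congr_ae ?_
  filter_upwards [h.ae_eq] with z hz
  rw [hz]
  ring

theorem IsRepresenting.integrable_pow (h : IsRepresenting β k μ) {j : ℕ} (hj : j ≤ 2 * (4 * k)) :
    Integrable (fun z : ℝ × ℝ => z.1 ^ j) μ := by
  refine integrable_pow_of_le hj ?_ ?_
  · simpa using (h.2 0 0 (Or.inl (by omega))).1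
  · refine (h.2 0 (2 * k) (Or.inl (by omega))).1.congr ?_
    filter_upwards [h.ae_eq] with z hz
    rw [hz]
    ring

/-- For the indices outside the gap, `j % 4 + j / 4 ≤ 2k`, except at `8k - 5`, which is the extra
moment. -/
theorem IsRepresenting.agreeOffGap (hk : 1 ≤ k) (h : IsRepresenting β k μ) :
    AgreeOffGap (4 * k - 3) (uSeq β) (fun j => ∫ z : ℝ × ℝ, z.1 ^ j ∂μ) := by
  intro j hj
  rw [uSeq, ← (h.2 (j % 4) (j / 4) (by omega)).2]
  refine integral_congr_ae ?_
  filter_upwards [h.ae_eq] with z hz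
  rw [hz, ← pow_mul, ← pow_add, Nat.mod_add_div]

theorem IsRepresenting.isPositiveUpTo (hk : 1 ≤ k) (h : IsRepresenting β k μ) :
    IsPositiveUpTo (fun j => ∫ z : ℝ × ℝ, z.1 ^ j ∂μ) (4 * k - 3 + 3) :=
  isPositiveUpTo_integral fun _ hj => h.integrable_pow (by omega)

theorem exists_isRepresenting_of_atoms (hk : 1 ≤ k) (hrel : MomentRelations β k) {m : ℕ}
    {t w : Fin m → ℝ} (ht : Function.Injective t) (hw : ∀ l, 0 < w l)
    (h : AgreeOffGap (4 * k - 3) (atomicMoment t w) (uSeq β)) :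
    ∃ μ : Measure (ℝ × ℝ), IsRepresenting β k μ ∧ IsNAtomic m μ := by
  refine ⟨∑ l, ENNReal.ofReal (w l) • Measure.dirac (t l, t l ^ 4), ⟨?_, fun i j hij => ?_⟩,
    fun l => (t l, t l ^ 4), w, fun l l' hl => ht (congrArg Prod.fst hl), hw, rfl⟩
  · have hmeas : MeasurableSet {z : ℝ × ℝ | z.2 = z.1 ^ 4}ᶜ :=
      (measurableSet_eq_fun (by fun_prop) (by fun_prop)).compl
    simp [hmeas]
  · obtain ⟨h1, h2⟩ := integrable_and_integral_sum_dirac (fun l => (t l, t l ^ 4)) w hw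
      (fun z : ℝ × ℝ => z.1 ^ i * z.2 ^ j)
    refine ⟨h1, h2.trans ?_⟩
    have e : ∑ l, w l * (t l ^ i * (t l ^ 4) ^ j) = atomicMoment t w (i + 4 * j) :=
      Finset.sum_congr rfl fun l _ => by rw [← pow_mul, ← pow_add]
    -- No required exponent pair has `i + 4j` equal to `8k - 2` or `8k - 1`.
    rw [e, h _ (by omega)]
    rcases hij with hij | ⟨rfl, rfl⟩
    · exact (hrel.eq_uSeq i j hij).symm
    · rw [uSeq]
      congr 1 <;> omega

/-- The atoms lie on the curve, so distinct atoms have distinct first coordinates and the univariate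
statement applies. -/
theorem IsRepresenting.riesz_eq_zero_of_isNAtomic (h : IsRepresenting β k μ) {m n : ℕ}
    (hμ : IsNAtomic m μ) (hmn : m ≤ n) {f : ℝ[X]}
    (hf : ∀ j < n, riesz (fun j => ∫ z : ℝ × ℝ, z.1 ^ j ∂μ) (f * X ^ j) = 0) (g : ℝ[X]) :
    riesz (fun j => ∫ z : ℝ × ℝ, z.1 ^ j ∂μ) (f * g) = 0 := by
  obtain ⟨z, c, hz, hc, rfl⟩ := hμ
  have hb : (fun j => ∫ x : ℝ × ℝ, x.1 ^ j ∂(∑ l, ENNReal.ofReal (c l) • Measure.dirac (z l))) =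
      atomicMoment (fun l => (z l).1) c :=
    funext fun j => (integrable_and_integral_sum_dirac z c hc (fun x => x.1 ^ j)).2
  have hcurve : ∀ l, (z l).2 = (z l).1 ^ 4 := by
    intro l
    by_contra hne
    have h1 := h.1
    rw [Measure.finsetSum_apply, Finset.sum_eq_zero_iff] at h1
    have := h1 l (Finset.mem_univ l)
    have hmeas : MeasurableSet {z : ℝ × ℝ | z.2 = z.1 ^ 4}ᶜ :=
      (measurableSet_eq_fun (by fun_prop) (by fun_prop)).compl
    have hc' := hc l
    simp [Measure.dirac_apply' _ hmeas, hne] at this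
    linarith
  rw [hb] at hf ⊢
  refine riesz_atomicMoment_eq_zero (fun l l' hl => hz (Prod.ext hl ?_)) hc hmn hf g
  rw [hcurve, hcurve]
  exact congrArg (· ^ 4) hl

end transfer

/-! ### The data of the criterion in terms of the univariate sequence -/

section data
variable (β : ℕ → ℕ → ℝ) {k : ℕ}

theorem vecU_eq (hk : 1 ≤ k) :
    vecU β k = window (uSeq β) (4 * k - 3 + 1) (4 * k - 3 + 3) := by
  funext i; rw [vecU, window]; congr 1; omega

theorem vecS_eq (hk : 1 ≤ k) :
    vecS β k = window (uSeq β) (4 * k - 3 + 2) (4 * k - 3 + 2) := by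
  funext i; rw [vecS, window]; congr 1; omega

theorem vecW_eq (hk : 1 ≤ k) :
    vecW β k = window (uSeq β) (4 * k - 3 + 1) (4 * k - 3 + 1) := by
  funext i; rw [vecW, window]; congr 1; omega

theorem ATilde_eq (k : ℕ) : ATilde β k = bordered (AHat β k)
    (window (uSeq β) (4 * k - 3 + 1) (4 * k - 3 + 1)) (uSeq β (2 * (4 * k - 3 + 1))) := by
  rw [ATilde, hankel_succ_eq_bordered, two_mul]
  rfl

theorem AWide_eq (hk : 1 ≤ k) : AWide β k = bordered (AHat β k)
    (window (uSeq β) (4 * k - 3 + 1) (4 * k - 3 + 3)) (uSeq β (2 * (4 * k - 3 + 3))) := by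
  rw [AWide, vecU_eq β hk]
  congr 1
  rw [uSeq]
  congr 1 <;> omega

theorem radicand_eq (hk : 1 ≤ k) : radicand β k =
    schurGap (uSeq β) (4 * k - 3) (4 * k - 3 + 1) *
      schurGap (uSeq β) (4 * k - 3) (4 * k - 3 + 3) := by
  rw [radicand, ATilde_eq, AWide_eq β hk, schurCompl_bordered, schurCompl_bordered]
  rfl

theorem mpForm_vecS_eq (hk : 1 ≤ k) :
    mpForm (ATilde β k) (vecS β k) (vecS β k) = lowerBound (uSeq β) (4 * k - 3) := by
  rw [vecS_eq β hk]
  rfl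

theorem mpForm_vecU_vecW_eq (hk : 1 ≤ k) :
    mpForm (AHat β k) (vecU β k) (vecW β k) = center (uSeq β) (4 * k - 3) := by
  rw [vecU_eq β hk, vecW_eq β hk]
  rfl

variable {β}

theorem rank_bordered_hankel_iff {b : ℕ → ℝ} {N d : ℕ} :
    (hankel b N).rank = (bordered (hankel b N) (window b (N + 1) d) (b (2 * d))).rank ↔
      (∃ g, hankel b N *ᵥ g = window b (N + 1) d) ∧ schurGap b N d = 0 := by
  rw [rank_bordered_eq_iff (hankel_transpose b N)]
  have key : ∀ g, hankel b N *ᵥ g = window b (N + 1) d →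
      schurGap b N d = b (2 * d) - g ⬝ᵥ window b (N + 1) d := by
    intro g hg
    rw [schurGap, ← hg, mpForm_mulVec (hankel_transpose b N)]
  constructor
  · rintro ⟨g, hg, he⟩
    exact ⟨⟨g, hg⟩, by rw [key g hg, he, sub_self]⟩
  · rintro ⟨⟨g, hg⟩, he⟩
    refine ⟨g, hg, ?_⟩
    rw [key g hg] at he
    linarith

/-- Each rank equality says that a bordering is flat: solvability of the systems gives the gap
system, and the corner entries give the vanishing Schur complements. -/
theorem rank_conditions_iff (hk : 1 ≤ k) :
    ((AHat β k).rank = (ATilde β k).rank ∧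
      (ATilde β k).rank =
        (Matrix.fromCols (ATilde β k) (Matrix.replicateCol (Fin 1) (vecS β k))).rank ∧
      (Matrix.fromCols (ATilde β k) (Matrix.replicateCol (Fin 1) (vecS β k))).rank =
        (AWide β k).rank) ↔
    (∃ p q r, IsGapSystem (uSeq β) (4 * k - 3) p q r) ∧
      schurGap (uSeq β) (4 * k - 3) (4 * k - 3 + 1) = 0 ∧
      schurGap (uSeq β) (4 * k - 3) (4 * k - 3 + 3) = 0 := by
  have h1 := rank_bordered_hankel_iff (b := uSeq β) (N := 4 * k - 3) (d := 4 * k - 3 + 1)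
  have h2 := rank_bordered_hankel_iff (b := uSeq β) (N := 4 * k - 3) (d := 4 * k - 3 + 3)
  rw [← AHat, ← ATilde_eq] at h1
  rw [← AHat, ← AWide_eq β hk] at h2
  have h3 := rank_fromCols_replicateCol_eq_iff (ATilde β k) (vecS β k)
  constructor
  · rintro ⟨r1, r2, r3⟩
    obtain ⟨g1, e1⟩ := h1.mp r1
    obtain ⟨g2, e2⟩ := h2.mp (r1.trans (r2.trans r3))
    have g3 := h3.mp r2
    rw [vecS_eq β hk] at g3
    exact ⟨exists_isGapSystem g1 g2 g3, e1, e2⟩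
  · rintro ⟨⟨p, q, r, h⟩, e1, e2⟩
    have r1 := h1.mpr ⟨⟨_, (hankel_mulVec_eq_window_iff _).mpr
      (by rw [vecPoly_coeff h.deg_p]; exact h.orth_p)⟩, e1⟩
    have r2 := h2.mpr ⟨⟨_, (hankel_mulVec_eq_window_iff _).mpr
      (by rw [vecPoly_coeff h.deg_q]; exact h.orth_q)⟩, e2⟩
    have r3 := h3.mpr (by
      rw [vecS_eq β hk]
      exact ⟨_, (hankel_mulVec_eq_window_iff _).mpr
        (by rw [vecPoly_coeff h.deg_r]; exact h.orth_r)⟩)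
    exact ⟨r1, r3, r3.symm.trans (r1.symm.trans r2)⟩

end data

/-! ### Necessity of the criterion -/

section criterion
variable {β : ℕ → ℕ → ℝ} {k : ℕ} {μ : Measure (ℝ × ℝ)}

theorem IsRepresenting.posSemidef_hankel (hk : 1 ≤ k) (h : IsRepresenting β k μ) :
    (hankel (uSeq β) (4 * k - 3 + 1)).PosSemidef := by
  rw [(h.agreeOffGap hk).hankel_eq le_rfl]
  exact (h.isPositiveUpTo hk).posSemidef_hankel (by omega)

theorem IsRepresenting.criterion (hk : 1 ≤ k) (h : IsRepresenting β k μ) :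
    (0 ≤ schurGap (uSeq β) (4 * k - 3) (4 * k - 3 + 1) *
        schurGap (uSeq β) (4 * k - 3) (4 * k - 3 + 3) ∧
      lowerBound (uSeq β) (4 * k - 3) ≤ center (uSeq β) (4 * k - 3) +
        √(schurGap (uSeq β) (4 * k - 3) (4 * k - 3 + 1) *
          schurGap (uSeq β) (4 * k - 3) (4 * k - 3 + 3))) ∧
    ((hankel (uSeq β) (4 * k - 3 + 1)).PosDef ∨
      (∃ p q r, IsGapSystem (uSeq β) (4 * k - 3) p q r) ∧
      schurGap (uSeq β) (4 * k - 3) (4 * k - 3 + 1) = 0 ∧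
      schurGap (uSeq β) (4 * k - 3) (4 * k - 3 + 3) = 0) := by
  have ha := h.agreeOffGap hk
  have hb := h.isPositiveUpTo hk
  obtain ⟨p, q, r, hG⟩ := hb.exists_isGapSystem
  rw [ha.schurGap_p_eq, ha.schurGap_q_eq, ha.lowerBound_eq, ha.center_eq, ha.hankel_eq le_rfl]
  refine ⟨⟨mul_nonneg (hb.schurGap_p_nonneg hG) (hb.schurGap_q_nonneg hG), ?_⟩, ?_⟩
  · have := le_of_abs_le (Real.abs_le_sqrt (hb.sub_center_sq_le hG))
    linarith [hb.lowerBound_le hG]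
  · by_cases hpd : (hankel (fun j => ∫ z : ℝ × ℝ, z.1 ^ j ∂μ) (4 * k - 3 + 1)).PosDef
    · exact Or.inl hpd
    · exact Or.inr ⟨⟨p, q, r, hG.congr ha.symm⟩, hb.schurGap_eq_zero_of_not_posDef hG hpd⟩

theorem IsRepresenting.lowerBound_mem (hk : 1 ≤ k) (h : IsRepresenting β k μ)
    (hμ : IsNAtomic (seqRank (uSeq β) (4 * k - 3 + 1)) μ) :
    lowerBound (uSeq β) (4 * k - 3) ∈ ({center (uSeq β) (4 * k - 3) -
        √(schurGap (uSeq β) (4 * k - 3) (4 * k - 3 + 1) *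
          schurGap (uSeq β) (4 * k - 3) (4 * k - 3 + 3)),
      center (uSeq β) (4 * k - 3) +
        √(schurGap (uSeq β) (4 * k - 3) (4 * k - 3 + 1) *
          schurGap (uSeq β) (4 * k - 3) (4 * k - 3 + 3))} : Set ℝ) := by
  have ha := h.agreeOffGap hk
  rw [ha.schurGap_p_eq, ha.schurGap_q_eq, ha.lowerBound_eq, ha.center_eq]
  exact (h.isPositiveUpTo hk).lowerBound_mem fun f hf =>
    h.riesz_eq_zero_of_isNAtomic hμ (seqRank_le (h.posSemidef_hankel hk)) hf f

end criterion

end CurveTMP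

/-! ### The theorem -/

theorem corollary3p6 (k : ℕ) (hk : 1 ≤ k) (β : ℕ → ℕ → ℝ)
    (hpsd : (momentMatrix β k).PosSemidef) (hrg : RecursivelyGenerated β k) :
    ((∃ μ : Measure (ℝ × ℝ), IsRepresenting β k μ) ↔
      (0 ≤ radicand β k ∧
        mpForm (ATilde β k) (vecS β k) (vecS β k) ≤
          mpForm (AHat β k) (vecU β k) (vecW β k) + Real.sqrt (radicand β k)) ∧
      CurveRelations β k ∧
      ((ATilde β k).PosDef ∨
        ((ATilde β k).PosSemidef ∧
          (AHat β k).rank = (ATilde β k).rank ∧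
          (ATilde β k).rank =
            (Matrix.fromCols (ATilde β k) (Matrix.replicateCol (Fin 1) (vecS β k))).rank ∧
          (Matrix.fromCols (ATilde β k) (Matrix.replicateCol (Fin 1) (vecS β k))).rank =
            (AWide β k).rank))) ∧
    ((∃ μ : Measure (ℝ × ℝ), IsRepresenting β k μ) →
      ((∃ μ : Measure (ℝ × ℝ), IsRepresenting β k μ ∧ IsNAtomic (rankTilde β k) μ) ↔
        mpForm (ATilde β k) (vecS β k) (vecS β k) ∈
          ({mpForm (AHat β k) (vecU β k) (vecW β k) - Real.sqrt (radicand β k),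
            mpForm (AHat β k) (vecU β k) (vecW β k) + Real.sqrt (radicand β k)} : Set ℝ)) ∧
      (mpForm (ATilde β k) (vecS β k) (vecS β k) ∉
          ({mpForm (AHat β k) (vecU β k) (vecW β k) - Real.sqrt (radicand β k),
            mpForm (AHat β k) (vecU β k) (vecW β k) + Real.sqrt (radicand β k)} : Set ℝ) →
        ∃ μ : Measure (ℝ × ℝ), IsRepresenting β k μ ∧ IsNAtomic (rankTilde β k + 1) μ)) := by
  have hrank : (ATilde β k).PosDef ∨
      ((ATilde β k).PosSemidef ∧
        (AHat β k).rank = (ATilde β k).rank ∧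
        (ATilde β k).rank =
          (Matrix.fromCols (ATilde β k) (Matrix.replicateCol (Fin 1) (vecS β k))).rank ∧
        (Matrix.fromCols (ATilde β k) (Matrix.replicateCol (Fin 1) (vecS β k))).rank =
          (AWide β k).rank) ↔
      (ATilde β k).PosDef ∨ ((ATilde β k).PosSemidef ∧ _) :=
    or_congr_right (and_congr_right fun _ => rank_conditions_iff hk)
  rw [hrank, radicand_eq β hk, mpForm_vecS_eq β hk, mpForm_vecU_vecW_eq β hk, rankTilde, ATilde]
  set b := uSeq β
  set N := 4 * k - 3
  have minimal : MomentRelations β k →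
      0 ≤ schurGap b N (N + 1) * schurGap b N (N + 3) →
      ((hankel b (N + 1)).PosDef ∨ ((hankel b (N + 1)).PosSemidef ∧
        (∃ p q r, IsGapSystem b N p q r) ∧
        schurGap b N (N + 1) = 0 ∧ schurGap b N (N + 3) = 0)) →
      (¬ (hankel b (N + 1)).PosDef ∨ lowerBound b N ∈
        ({center b N - √(schurGap b N (N + 1) * schurGap b N (N + 3)),
          center b N + √(schurGap b N (N + 1) * schurGap b N (N + 3))} : Set ℝ)) →
      ∃ μ : Measure (ℝ × ℝ), IsRepresenting β k μ ∧ IsNAtomic (seqRank b (N + 1)) μ := by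
    intro hrel h0 hpos hmem
    by_cases hpd : (hankel b (N + 1)).PosDef
    · obtain ⟨t, w, ht, hw, hagree⟩ :=
        exists_atoms_of_lowerBound_mem hpd h0 (hmem.resolve_left (not_not.mpr hpd))
      rw [seqRank_of_posDef hpd]
      exact exists_isRepresenting_of_atoms hk hrel ht hw hagree
    · obtain ⟨hpsd', ⟨p, q, r, hG⟩, hp, hq⟩ := hpos.resolve_left hpd
      obtain ⟨t, w, ht, hw, hagree⟩ := exists_atoms_of_not_posDef hpsd' hpd hG hp hq
      exact exists_isRepresenting_of_atoms hk hrel ht hw hagree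
  have next : MomentRelations β k →
      0 ≤ schurGap b N (N + 1) * schurGap b N (N + 3) →
      (hankel b (N + 1)).PosDef →
      lowerBound b N < center b N + √(schurGap b N (N + 1) * schurGap b N (N + 3)) →
      ∃ μ : Measure (ℝ × ℝ), IsRepresenting β k μ ∧ IsNAtomic (seqRank b (N + 1) + 1) μ := by
    intro hrel h0 hpd hlt
    obtain ⟨t, w, ht, hw, hagree⟩ := exists_atoms_of_lowerBound_lt hpd h0 hlt
    rw [seqRank_of_posDef hpd]
    exact exists_isRepresenting_of_atoms hk hrel ht hw hagree
  have hpos : ∀ μ : Measure (ℝ × ℝ), IsRepresenting β k μ →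
      ((hankel b (N + 1)).PosDef ∨ ((hankel b (N + 1)).PosSemidef ∧
        (∃ p q r, IsGapSystem b N p q r) ∧
        schurGap b N (N + 1) = 0 ∧ schurGap b N (N + 3) = 0)) := fun μ h =>
    (h.criterion hk).2.imp_right fun h' => ⟨h.posSemidef_hankel hk, h'⟩
  refine ⟨⟨?_, ?_⟩, ?_⟩
  · rintro ⟨μ, h⟩
    exact ⟨(h.criterion hk).1, h.momentRelations.curveRelations, hpos μ h⟩
  · rintro ⟨⟨h0, hle⟩, hcurve, hpos⟩
    have hrel := hcurve.momentRelations hk hrg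
    by_cases hpd : (hankel b (N + 1)).PosDef
    · rcases hle.eq_or_lt with heq | hlt
      · obtain ⟨μ, h, -⟩ := minimal hrel h0 hpos (Or.inr (Or.inr heq))
        exact ⟨μ, h⟩
      · obtain ⟨μ, h, -⟩ := next hrel h0 hpd hlt
        exact ⟨μ, h⟩
    · obtain ⟨μ, h, -⟩ := minimal hrel h0 hpos (Or.inl hpd)
      exact ⟨μ, h⟩
  · rintro ⟨μ, h⟩
    have hrel := h.momentRelations
    obtain ⟨⟨h0, hle⟩, -⟩ := h.criterion hk
    refine ⟨⟨?_, fun hmem => minimal hrel h0 (hpos μ h) (Or.inr hmem)⟩, fun hmem => ?_⟩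
    · rintro ⟨ν, hν, hν'⟩
      exact hν.lowerBound_mem hk hν'
    -- A singular Hankel matrix would yield a measure with `seqRank` atoms, which forces
    -- `lowerBound` to be a root.
    · have hpd : (hankel b (N + 1)).PosDef := by
        by_contra hpd
        obtain ⟨ν, hν, hν'⟩ := minimal hrel h0 (hpos μ h) (Or.inl hpd)
        exact hmem (hν.lowerBound_mem hk hν')
      exact next hrel h0 hpd (lt_of_le_of_ne hle fun heq => hmem (Or.inr heq))
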